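/- Let $n\ge 0$. A composition is a finite sequence $\alpha=(\alpha_1,\dots,\alpha_\ell)$ of positive integers, with length $\ell(\alpha)=\ell$. Its diagram $D(\alpha)$ consists of left-justified rows, numbered from bottom to top, whose $i$-th row has $\alpha_i$ boxes. For a filling $T$ of $D(\alpha)$ with entries in $\{1,\dots,n\}$, let $T(i,c)$ be the entry in row $i$ and column $c$, and let $x^{\mathrm{wt}(T)}=\prod_{(i,c)\in D(\alpha)}x_{T(i,c)}$. Let $\mathrm{RCT}_n(\alpha)$ be the set of such fillings whose rows weakly decrease from left to right, whose first column strictly increases from bottom to top, and such that for all rows $i<j$ and columns $c$: - if $\alpha_j\le\alpha_i$ and $c+1\le\alpha_j$, then it is not the case that $T(i,c)\ge T(j,c+1)\ge T(i,c+1)$; - if $\alpha_i<\alpha_j$, $c\le\alpha_i$ and $c+1\le\alpha_j$, then it is not the case that $T(j,c)\ge T(i,c)\ge T(j,c+1)$. Let $\mathrm{YCT}_n(\alpha)$ be the set of such fillings whose rows weakly increase from left to right, whose first column strictly increases from bottom to top, and such that for all rows $i<j$ and columns $c$: - if $\alpha_i\le\alpha_j$ and $c+1\le\alpha_i$, then it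 is not the case that $T(j,c+1)\ge T(i,c+1)\ge T(j,c)$; - if $\alpha_j<\alpha_i$, $c\le\alpha_j$ and $c+1\le\alpha_i$, then it is not the case that $T(i,c+1)\ge T(j,c)\ge T(i,c)$. The quasisymmetric Schur polynomial and the Young quasisymmetric Schur polynomial of $\alpha$ are the elements $$\mathcal{QS}_\alpha(x_1,\dots,x_n)=\sum_{T\in\mathrm{RCT}_n(\alpha)}x^{\mathrm{wt}(T)},\qquad \mathcal{YQS}_\alpha(x_1,\dots,x_n)=\sum_{T\in\mathrm{YCT}_n(\alpha)}x^{\mathrm{wt}(T)}$$ of $\mathbb{Z}[x_1,\dots,x_n]$. **Theorem.** Let $\alpha$ and $\beta$ be compositions with at most $n$ parts. Then $\mathcal{YQS}_\alpha(x_1,\dots,x_n)=\mathcal{QS}_\beta(x_1,\dots,x_n)$ if and only if $\alpha=\beta$ and at least one of the following holds: 1. all parts of $\alpha$ are equal; 2. every part of $\alpha$ is $1$ or $2$; 3. $n=\ell(\alpha)$ and $|\alpha_i-\alpha_{i+1}|\le 1$ for all $1\le i<\ell(\alpha)$. -/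

import Mathlib

/-!
Compositions are Mathlib's `Composition m` (finite sequences of positive integers with sum `m`).
Rows and columns of a diagram are numbered from `0`, rows from bottom to top; the entry `v : Fin n`
stands for the positive integer `v + 1 ≤ n`, and `X v` for the variable `x_{v+1}`.
-/

namespace QSchur

/-- Tableaux of shape `α` with entries at most `n`: the row `i` of the diagram has `α_i` boxes,
and `T i c` is the entry of the box in row `i` and column `c`. -/
abbrev Tableau {m : ℕ} (α : Composition m) (n : ℕ) : Type :=
  (i : Fin α.length) → Fin (α.blocksFun i) → Fin n

variable {m : ℕ} {α : Composition m} {n : ℕ}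

/-- The weight of a tableau: the coordinate at `v` is the number of boxes with entry `v`. -/
noncomputable def weight (T : Tableau α n) : Fin n →₀ ℕ :=
  ∑ i, ∑ c, Finsupp.single (T i c) 1

/-- Entries strictly increase from bottom to top in the first column. -/
def FirstColumnIncreasing (T : Tableau α n) : Prop :=
  ∀ i j : Fin α.length, i < j →
    T i ⟨0, α.one_le_blocksFun i⟩ < T j ⟨0, α.one_le_blocksFun j⟩

/-- All type A triples are inversion triples. In a type A triple, `z, x` are adjacent in row `i`,
and `y` is above `x` in a row `j` that is weakly shorter than row `i`. -/
def TypeAInversion (T : Tableau α n) : Prop :=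
  ∀ i j : Fin α.length, i < j → α.blocksFun j ≤ α.blocksFun i →
    ∀ (c : ℕ) (hi : c + 1 < α.blocksFun i) (hj : c + 1 < α.blocksFun j),
      let z := T i ⟨c, Nat.lt_of_succ_lt hi⟩
      let x := T i ⟨c + 1, hi⟩
      let y := T j ⟨c + 1, hj⟩
      ¬ (z ≥ y ∧ y ≥ x)

/-- All type B triples are inversion triples. In a type B triple, `z, x` are adjacent in row `j`,
and `y` is below `z` in a row `i` that is strictly shorter than row `j`. -/
def TypeBInversion (T : Tableau α n) : Prop :=
  ∀ i j : Fin α.length, i < j → α.blocksFun i < α.blocksFun j →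
    ∀ (c : ℕ) (hj : c + 1 < α.blocksFun j) (hi : c < α.blocksFun i),
      let z := T j ⟨c, Nat.lt_of_succ_lt hj⟩
      let x := T j ⟨c + 1, hj⟩
      let y := T i ⟨c, hi⟩
      ¬ (z ≥ y ∧ y ≥ x)

/-- All type I Young triples are Young inversion triples. In a type I triple, `z, x` are adjacent
in row `j`, and `y` is below `x` in a row `i` that is weakly shorter than row `j`. -/
def TypeIInversion (T : Tableau α n) : Prop :=
  ∀ i j : Fin α.length, i < j → α.blocksFun i ≤ α.blocksFun j →
    ∀ (c : ℕ) (hj : c + 1 < α.blocksFun j) (hi : c + 1 < α.blocksFun i),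
      let z := T j ⟨c, Nat.lt_of_succ_lt hj⟩
      let x := T j ⟨c + 1, hj⟩
      let y := T i ⟨c + 1, hi⟩
      ¬ (x ≥ y ∧ y ≥ z)

/-- All type II Young triples are Young inversion triples. In a type II triple, `z, x` are adjacent
in row `i`, and `y` is above `z` in a row `j` that is strictly shorter than row `i`. -/
def TypeIIInversion (T : Tableau α n) : Prop :=
  ∀ i j : Fin α.length, i < j → α.blocksFun j < α.blocksFun i →
    ∀ (c : ℕ) (hi : c + 1 < α.blocksFun i) (hj : c < α.blocksFun j),
      let z := T i ⟨c, Nat.lt_of_succ_lt hi⟩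
      let x := T i ⟨c + 1, hi⟩
      let y := T j ⟨c, hj⟩
      ¬ (x ≥ y ∧ y ≥ z)

/-- Semistandard reverse composition tableaux: rows weakly decrease from left to right. -/
def IsRCT (T : Tableau α n) : Prop :=
  (∀ i, Antitone (T i)) ∧ FirstColumnIncreasing T ∧ TypeAInversion T ∧ TypeBInversion T

/-- Young semistandard composition tableaux: rows weakly increase from left to right. -/
def IsYCT (T : Tableau α n) : Prop :=
  (∀ i, Monotone (T i)) ∧ FirstColumnIncreasing T ∧ TypeIInversion T ∧ TypeIIInversion T

open Classical in
/-- The quasisymmetric Schur polynomial of `α` in `n` variables. -/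
noncomputable def qs {m : ℕ} (α : Composition m) (n : ℕ) : MvPolynomial (Fin n) ℤ :=
  ∑ T : Tableau α n with IsRCT T, MvPolynomial.monomial (weight T) 1

open Classical in
/-- The Young quasisymmetric Schur polynomial of `α` in `n` variables. -/
noncomputable def yqs {m : ℕ} (α : Composition m) (n : ℕ) : MvPolynomial (Fin n) ℤ :=
  ∑ T : Tableau α n with IsYCT T, MvPolynomial.monomial (weight T) 1

end QSchur

/-! Reversing the order of the rows and complementing the entries turns Young tableaux of shape `a`
into reverse tableaux of the reversed shape. So equality of the two polynomials of `a` says that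
`revPoly` of the reversed shape is `revPoly a` with its variables reversed.

Equality forces equal shapes. Both kinds of tableau have distinct entries in each column, and both
include the filling `diag` with constant rows. Realising the weight of each `diag` by a tableau of
the other kind gives equal lengths and equal sums `∑ min (a i) c`. This tightness forces the reverse
tableau to be `diag` itself (`IsReverse.eq_diag`), so the shapes agree.

Necessity of the conditions uses only which weights occur, since coefficients count tableaux and
cannot cancel. If adjacent parts differ by at least 2, changing one box of `diag` gives a weight
that only one kind attains. If `l < n`, a similar change in a filling that skips one value shows
that adjacent parts that are both at least 2 are equal. Together these leave the three listed cases.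

Sufficiency: in the full-length case `diag` is the only tableau of either kind. In the other two
cases a tableau is determined by its column sets: given one column, the next is recovered from its
set of entries by a greedy choice (`exists_step`, `Step.unique`). The admissible sequences of sets
are preserved by complementing and reversing their order, which proves the required symmetry under
reversal of the variables. -/

namespace QSchur

open Finset

/-- Fillings, with entries in `Fin n`, of the diagram with row lengths `a`. -/
abbrev Tab {l : ℕ} (a : Fin l → ℕ) (n : ℕ) : Type :=
  (i : Fin l) → Fin (a i) → Fin n

/-! ### Fillings, weights and the rotation symmetry -/

section Basic

variable {l l' n : ℕ} {a : Fin l → ℕ} {b : Fin l' → ℕ}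

/-- Reverse composition tableaux of shape `a`. -/
structure IsReverse (T : Tab a n) : Prop where
  row : ∀ i, Antitone (T i)
  col : ∀ i j, i < j → ∀ (hi : 0 < a i) (hj : 0 < a j), T i ⟨0, hi⟩ < T j ⟨0, hj⟩
  typeA : ∀ i j, i < j → a j ≤ a i → ∀ (c : ℕ) (hi : c + 1 < a i) (hj : c + 1 < a j),
    T j ⟨c + 1, hj⟩ ≤ T i ⟨c, Nat.lt_of_succ_lt hi⟩ → ¬ T i ⟨c + 1, hi⟩ ≤ T j ⟨c + 1, hj⟩
  typeB : ∀ i j, i < j → a i < a j → ∀ (c : ℕ) (hj : c + 1 < a j) (hi : c < a i),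
    T i ⟨c, hi⟩ ≤ T j ⟨c, Nat.lt_of_succ_lt hj⟩ → ¬ T j ⟨c + 1, hj⟩ ≤ T i ⟨c, hi⟩

/-- Young composition tableaux of shape `a`. -/
structure IsYoung (T : Tab a n) : Prop where
  row : ∀ i, Monotone (T i)
  col : ∀ i j, i < j → ∀ (hi : 0 < a i) (hj : 0 < a j), T i ⟨0, hi⟩ < T j ⟨0, hj⟩
  typeI : ∀ i j, i < j → a i ≤ a j → ∀ (c : ℕ) (hj : c + 1 < a j) (hi : c + 1 < a i),
    T i ⟨c + 1, hi⟩ ≤ T j ⟨c + 1, hj⟩ → ¬ T j ⟨c, Nat.lt_of_succ_lt hj⟩ ≤ T i ⟨c + 1, hi⟩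
  typeII : ∀ i j, i < j → a j < a i → ∀ (c : ℕ) (hi : c + 1 < a i) (hj : c < a j),
    T j ⟨c, hj⟩ ≤ T i ⟨c + 1, hi⟩ → ¬ T i ⟨c, Nat.lt_of_succ_lt hi⟩ ≤ T j ⟨c, hj⟩

/-- The weight of a filling. -/
noncomputable def wt (T : Tab a n) : Fin n →₀ ℕ :=
  ∑ i, ∑ c, Finsupp.single (T i c) 1

open Classical in
/-- The generating polynomial of the reverse composition tableaux of shape `a`. -/
noncomputable def revPoly (a : Fin l → ℕ) (n : ℕ) : MvPolynomial (Fin n) ℤ :=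
  ∑ T : Tab a n with IsReverse T, MvPolynomial.monomial (wt T) 1

open Classical in
/-- The generating polynomial of the Young composition tableaux of shape `a`. -/
noncomputable def youngPoly (a : Fin l → ℕ) (n : ℕ) : MvPolynomial (Fin n) ℤ :=
  ∑ T : Tab a n with IsYoung T, MvPolynomial.monomial (wt T) 1

theorem qs_eq {m : ℕ} (α : Composition m) (n : ℕ) : qs α n = revPoly α.blocksFun n := by
  classical
  unfold qs revPoly
  have : ∀ T : Tab α.blocksFun n, IsRCT T ↔ IsReverse T := fun T =>
    ⟨fun h => ⟨h.1, fun i j hij _ _ => h.2.1 i j hij,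
      fun i j hij hl c hi hj h1 h2 => h.2.2.1 i j hij hl c hi hj ⟨h1, h2⟩,
      fun i j hij hl c hi hj h1 h2 => h.2.2.2 i j hij hl c hi hj ⟨h1, h2⟩⟩,
    fun h => ⟨h.row, fun i j hij => h.col i j hij _ _,
      fun i j hij hl c hi hj h1 => h.typeA i j hij hl c hi hj h1.1 h1.2,
      fun i j hij hl c hi hj h1 => h.typeB i j hij hl c hi hj h1.1 h1.2⟩⟩
  exact Finset.sum_congr (Finset.filter_congr fun T _ => this T) fun _ _ => rfl

theorem yqs_eq {m : ℕ} (α : Composition m) (n : ℕ) : yqs α n = youngPoly α.blocksFun n := by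
  classical
  unfold yqs youngPoly
  have : ∀ T : Tab α.blocksFun n, IsYCT T ↔ IsYoung T := fun T =>
    ⟨fun h => ⟨h.1, fun i j hij _ _ => h.2.1 i j hij,
      fun i j hij hl c hi hj h1 h2 => h.2.2.1 i j hij hl c hi hj ⟨h1, h2⟩,
      fun i j hij hl c hi hj h1 h2 => h.2.2.2 i j hij hl c hi hj ⟨h1, h2⟩⟩,
    fun h => ⟨h.row, fun i j hij => h.col i j hij _ _,
      fun i j hij hl c hi hj h1 => h.typeI i j hij hl c hi hj h1.1 h1.2,
      fun i j hij hl c hi hj h1 => h.typeII i j hij hl c hi hj h1.1 h1.2⟩⟩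
  exact Finset.sum_congr (Finset.filter_congr fun T _ => this T) fun _ _ => rfl

/-- No cancellation is possible: the coefficient counts the indices `x` with `f x = w`. -/
theorem coeff_sum_monomial_ne_zero {ι σ : Type*} (s : Finset ι) (f : ι → σ →₀ ℕ) (w : σ →₀ ℕ) :
    MvPolynomial.coeff w (∑ x ∈ s, MvPolynomial.monomial (f x) (1 : ℤ)) ≠ 0 ↔
      ∃ x ∈ s, f x = w := by
  classical
  rw [MvPolynomial.coeff_sum]
  simp only [MvPolynomial.coeff_monomial, ne_eq]
  rw [Finset.sum_ite, Finset.sum_const_zero, add_zero, Finset.sum_const, nsmul_eq_mul, mul_one,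
    Nat.cast_eq_zero, Finset.card_eq_zero]
  rw [← ne_eq, ← Finset.nonempty_iff_ne_empty]
  simp [Finset.Nonempty]

theorem coeff_revPoly_ne_zero (w : Fin n →₀ ℕ) :
    MvPolynomial.coeff w (revPoly a n) ≠ 0 ↔ ∃ T : Tab a n, IsReverse T ∧ wt T = w := by
  classical
  unfold revPoly
  rw [coeff_sum_monomial_ne_zero]
  simp

theorem coeff_youngPoly_ne_zero (w : Fin n →₀ ℕ) :
    MvPolynomial.coeff w (youngPoly a n) ≠ 0 ↔ ∃ T : Tab a n, IsYoung T ∧ wt T = w := by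
  classical
  unfold youngPoly
  rw [coeff_sum_monomial_ne_zero]
  simp

/-- The number of boxes whose entry satisfies `P`. -/
def cnt (T : Tab a n) (P : Fin n → Prop) [DecidablePred P] : ℕ :=
  ∑ i, #{c | P (T i c)}

theorem wt_apply (T : Tab a n) (v : Fin n) : wt T v = cnt T (· = v) := by
  classical
  simp only [wt, cnt, Finsupp.finsetSum_apply, Finsupp.single_apply, Finset.card_filter]

theorem cnt_eq_sum_wt (T : Tab a n) (P : Fin n → Prop) [DecidablePred P] :
    cnt T P = ∑ v with P v, wt T v := by
  simp only [wt_apply, cnt]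
  rw [Finset.sum_comm]
  refine Finset.sum_congr rfl fun i _ => ?_
  rw [Finset.card_eq_sum_card_fiberwise (f := T i) (t := ({v | P v} : Finset (Fin n)))
    (fun c hc => by simpa using hc)]
  refine Finset.sum_congr rfl fun v hv => ?_
  congr 1
  ext c
  simp only [Finset.mem_filter, Finset.mem_univ, true_and] at hv ⊢
  constructor
  · exact fun h => h.2
  · rintro rfl; exact ⟨hv, rfl⟩

theorem cnt_congr {T : Tab a n} {U : Tab b n} (h : wt T = wt U) (P : Fin n → Prop)
    [DecidablePred P] : cnt T P = cnt U P := by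
  rw [cnt_eq_sum_wt, cnt_eq_sum_wt, h]

theorem exists_entry {T : Tab a n} {U : Tab b n} (h : wt T = wt U) (i : Fin l) (c : Fin (a i)) :
    ∃ j d, U j d = T i c := by
  by_contra hne
  push Not at hne
  have h1 : cnt U (· = T i c) = 0 := by
    unfold cnt
    refine Finset.sum_eq_zero fun j _ => ?_
    rw [Finset.card_eq_zero, Finset.filter_eq_empty_iff]
    exact fun d _ => hne j d
  rw [← cnt_congr h, cnt, Finset.sum_eq_zero_iff] at h1
  have h2 := h1 i (Finset.mem_univ _)
  rw [Finset.card_eq_zero, Finset.filter_eq_empty_iff] at h2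
  exact h2 (Finset.mem_univ c) rfl

/-- The rotation of a filling: rows are taken in reverse order and entries are complemented. -/
def rotate (T : Tab a n) : Tab (fun i => a i.rev) n := fun i c => (T i.rev c).rev

theorem rotate_bijective : Function.Bijective (rotate : Tab a n → Tab (fun i => a i.rev) n) := by
  constructor
  · intro T U h
    have key : ∀ (i : Fin l) (c : Fin (a i.rev)), T (Fin.rev i) c = U (Fin.rev i) c := fun i c =>
      Fin.rev_injective (congrFun (congrFun h i) c)
    funext i
    have h2 := key i.rev
    rw [Fin.rev_rev] at h2
    exact funext h2
  · intro S
    refine ⟨fun i c => (S i.rev (Fin.cast (by simp only [Fin.rev_rev]) c)).rev, ?_⟩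
    funext i c
    simp only [rotate, Fin.rev_rev]
    have key : ∀ (j : Fin l) (h : j = i) (c : Fin (a i.rev)),
        S j (Fin.cast (by rw [h]) c) = S i c := by
      rintro j rfl c; rfl
    exact key _ (Fin.rev_rev i) c

theorem forall_rev {p : Fin l → Prop} : (∀ i, p (Fin.rev i)) ↔ ∀ i, p i :=
  ⟨fun h i => by simpa using h i.rev, fun h i => h _⟩

/-- Rotation exchanges type A with type I and type B with type II; complementation reverses the
order, so the two inequalities of a triple trade places. -/
theorem isReverse_rotate {T : Tab a n} : IsReverse (rotate T) ↔ IsYoung T := by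
  constructor
  · intro h
    refine ⟨?_, ?_, ?_, ?_⟩
    · rw [← forall_rev]
      intro i c d hcd
      exact Fin.rev_le_rev.1 (h.row i hcd)
    · rw [← forall_rev]; intro i; rw [← forall_rev]; intro j hij hi hj
      exact Fin.rev_lt_rev.1 (h.col j i (Fin.rev_lt_rev.1 hij) hj hi)
    · rw [← forall_rev]; intro i; rw [← forall_rev]; intro j hij hl c hj hi h1 h2
      exact h.typeA j i (Fin.rev_lt_rev.1 hij) hl c hj hi (Fin.rev_le_rev.2 h2)
        (Fin.rev_le_rev.2 h1)
    · rw [← forall_rev]; intro i; rw [← forall_rev]; intro j hij hl c hi hj h1 h2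
      exact h.typeB j i (Fin.rev_lt_rev.1 hij) hl c hi hj (Fin.rev_le_rev.2 h2)
        (Fin.rev_le_rev.2 h1)
  · intro h
    refine ⟨?_, ?_, ?_, ?_⟩
    · intro i c d hcd
      exact Fin.rev_le_rev.2 (h.row _ hcd)
    · intro i j hij hi hj
      exact Fin.rev_lt_rev.2 (h.col _ _ (Fin.rev_lt_rev.2 hij) hj hi)
    · intro i j hij hl c hi hj h1 h2
      exact h.typeI _ _ (Fin.rev_lt_rev.2 hij) hl c hi hj (Fin.rev_le_rev.1 h2)
        (Fin.rev_le_rev.1 h1)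
    · intro i j hij hl c hj hi h1 h2
      exact h.typeII _ _ (Fin.rev_lt_rev.2 hij) hl c hj hi (Fin.rev_le_rev.1 h2)
        (Fin.rev_le_rev.1 h1)

theorem isYoung_rotate {T : Tab a n} : IsYoung (rotate T) ↔ IsReverse T := by
  constructor
  · intro h
    refine ⟨?_, ?_, ?_, ?_⟩
    · rw [← forall_rev]
      intro i c d hcd
      exact Fin.rev_le_rev.1 (h.row i hcd)
    · rw [← forall_rev]; intro i; rw [← forall_rev]; intro j hij hi hj
      exact Fin.rev_lt_rev.1 (h.col j i (Fin.rev_lt_rev.1 hij) hj hi)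
    · rw [← forall_rev]; intro i; rw [← forall_rev]; intro j hij hl c hj hi h1 h2
      exact h.typeI j i (Fin.rev_lt_rev.1 hij) hl c hj hi (Fin.rev_le_rev.2 h2)
        (Fin.rev_le_rev.2 h1)
    · rw [← forall_rev]; intro i; rw [← forall_rev]; intro j hij hl c hi hj h1 h2
      exact h.typeII j i (Fin.rev_lt_rev.1 hij) hl c hi hj (Fin.rev_le_rev.2 h2)
        (Fin.rev_le_rev.2 h1)
  · intro h
    refine ⟨?_, ?_, ?_, ?_⟩
    · intro i c d hcd
      exact Fin.rev_le_rev.2 (h.row _ hcd)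
    · intro i j hij hi hj
      exact Fin.rev_lt_rev.2 (h.col _ _ (Fin.rev_lt_rev.2 hij) hj hi)
    · intro i j hij hl c hi hj h1 h2
      exact h.typeA _ _ (Fin.rev_lt_rev.2 hij) hl c hi hj (Fin.rev_le_rev.1 h2)
        (Fin.rev_le_rev.1 h1)
    · intro i j hij hl c hj hi h1 h2
      exact h.typeB _ _ (Fin.rev_lt_rev.2 hij) hl c hj hi (Fin.rev_le_rev.1 h2)
        (Fin.rev_le_rev.1 h1)

theorem wt_rotate (T : Tab a n) : wt (rotate T) = (wt T).mapDomain Fin.rev := by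
  simp only [wt, rotate, Finsupp.mapDomain_finsetSum, Finsupp.mapDomain_single]
  exact Equiv.sum_comp Fin.revPerm (fun i => ∑ c, Finsupp.single (T i c).rev 1)

theorem rename_rev_youngPoly (a : Fin l → ℕ) (n : ℕ) :
    MvPolynomial.rename Fin.rev (youngPoly a n) = revPoly (fun i => a i.rev) n := by
  classical
  unfold youngPoly revPoly
  rw [map_sum]
  refine Finset.sum_bij (fun T _ => rotate T) ?_ ?_ ?_ ?_
  · intro T hT
    simpa [isReverse_rotate] using hT
  · intro T _ U _ h
    exact rotate_bijective.1 h
  · intro S hS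
    obtain ⟨T, rfl⟩ := rotate_bijective.2 S
    exact ⟨T, by simpa [isReverse_rotate] using hS, rfl⟩
  · intro T _
    rw [MvPolynomial.rename_monomial, wt_rotate]

/-- Reverse and Young composition tableaux of shape `a` have the same weights. -/
def SameWeights (a : Fin l → ℕ) (n : ℕ) : Prop :=
  ∀ w : Fin n →₀ ℕ, (∃ T : Tab a n, IsReverse T ∧ wt T = w) ↔ ∃ T : Tab a n, IsYoung T ∧ wt T = w

theorem SameWeights.rev (h : SameWeights a n) : SameWeights (fun i => a i.rev) n := by
  intro w
  constructor
  · rintro ⟨S, hS, rfl⟩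
    obtain ⟨T, rfl⟩ := rotate_bijective.2 S
    obtain ⟨U, hU, hw⟩ := (h (wt T)).2 ⟨T, isReverse_rotate.1 hS, rfl⟩
    exact ⟨rotate U, isYoung_rotate.2 hU, by rw [wt_rotate, wt_rotate, hw]⟩
  · rintro ⟨S, hS, rfl⟩
    obtain ⟨T, rfl⟩ := rotate_bijective.2 S
    obtain ⟨U, hU, hw⟩ := (h (wt T)).1 ⟨T, isYoung_rotate.1 hS, rfl⟩
    exact ⟨rotate U, isReverse_rotate.2 hU, by rw [wt_rotate, wt_rotate, hw]⟩

end Basic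

/-! ### Dominance of weights, and recovery of the shape -/

section Support

variable {l l' n : ℕ} {a : Fin l → ℕ} {b : Fin l' → ℕ}

/-- An equality in a column, combined with weak decrease along a row, would produce a forbidden
triple: type A with the preceding column if the lower row is weakly longer, type B with the
following column otherwise. -/
theorem IsReverse.column_injective {T : Tab a n} (h : IsReverse T) {i j : Fin l} {c : ℕ}
    (hi : c < a i) (hj : c < a j) (e : T i ⟨c, hi⟩ = T j ⟨c, hj⟩) : i = j := by
  suffices key : ∀ i j : Fin l, i < j → ∀ (hi : c < a i) (hj : c < a j),
      T i ⟨c, hi⟩ ≠ T j ⟨c, hj⟩ by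
    rcases lt_trichotomy i j with hij | hij | hij
    · exact absurd e (key i j hij hi hj)
    · exact hij
    · exact absurd e.symm (key j i hij hj hi)
  intro i j hij hi hj e
  rcases le_or_gt (a j) (a i) with hl | hl
  · rcases c with _ | c
    · exact (h.col i j hij hi hj).ne e
    · refine h.typeA i j hij hl c hi hj ?_ e.le
      rw [← e]
      exact h.row i (by simp)
  · refine h.typeB i j hij hl c (by omega) hi e.le ?_
    rw [e]
    exact h.row j (by simp)

theorem IsYoung.column_injective {T : Tab a n} (h : IsYoung T) {i j : Fin l} {c : ℕ}
    (hi : c < a i) (hj : c < a j) (e : T i ⟨c, hi⟩ = T j ⟨c, hj⟩) : i = j := by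
  have key : ∀ (i j : Fin l) (hi : c < a i.rev) (hj : c < a j.rev),
      T i.rev ⟨c, hi⟩ = T j.rev ⟨c, hj⟩ → i.rev = j.rev := fun i j hi hj e =>
    congrArg Fin.rev ((isReverse_rotate.2 h).column_injective hi hj (congrArg Fin.rev e))
  revert hi hj e
  revert i
  rw [← forall_rev]
  intro i
  revert j
  rw [← forall_rev]
  exact fun j hi hj e => key i j hi hj e

/-- The filling of shape `a` all of whose entries in row `i` are `i`. -/
def diag (a : Fin l → ℕ) (h : l ≤ n) : Tab a n := fun i _ => Fin.castLE h i

theorem isReverse_diag (a : Fin l → ℕ) (h : l ≤ n) : IsReverse (diag a h) :=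
  ⟨fun _ _ _ _ => le_rfl, fun _ _ hij _ _ => hij,
    fun _ _ hij _ _ _ _ h1 _ => absurd hij (not_lt.2 h1),
    fun _ _ hij _ _ _ _ _ h2 => absurd hij (not_lt.2 h2)⟩

theorem isYoung_diag (a : Fin l → ℕ) (h : l ≤ n) : IsYoung (diag a h) :=
  ⟨fun _ _ _ _ => le_rfl, fun _ _ hij _ _ => hij,
    fun _ _ hij _ _ _ _ _ h2 => absurd hij (not_lt.2 h2),
    fun _ _ hij _ _ _ _ h1 _ => absurd hij (not_lt.2 h1)⟩

theorem wt_diag_apply (a : Fin l → ℕ) (h : l ≤ n) (i : Fin l) :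
    wt (diag a h) (Fin.castLE h i) = a i := by
  rw [wt_apply, cnt, Finset.sum_eq_single i]
  · simp [diag]
  · intro j _ hj
    simp [diag, hj]
  · simp

theorem wt_diag_apply_of_le (a : Fin l → ℕ) (h : l ≤ n) (v : Fin n) (hv : l ≤ v) :
    wt (diag a h) v = 0 := by
  rw [wt_apply, cnt]
  refine Finset.sum_eq_zero fun j _ => ?_
  rw [Finset.card_eq_zero, Finset.filter_eq_empty_iff]
  rintro c - rfl
  exact absurd j.2 (not_lt.2 hv)

/-- The number of boxes in the first `c` columns whose entry is `v`. -/
def colCount (T : Tab a n) (v : Fin n) (c : ℕ) : ℕ :=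
  #{x : Σ i, Fin (a i) | (x.2 : ℕ) < c ∧ T x.1 x.2 = v}

theorem wt_eq_card (T : Tab a n) (v : Fin n) :
    wt T v = #{x : Σ i, Fin (a i) | T x.1 x.2 = v} := by
  rw [wt_apply, cnt]
  simp only [Finset.card_filter]
  rw [← Finset.univ_sigma_univ, Finset.sum_sigma]

theorem sum_colCount (T : Tab a n) (c : ℕ) : ∑ v, colCount T v c = ∑ i, min (a i) c := by
  have h1 : ∑ v, colCount T v c = #{x : Σ i, Fin (a i) | (x.2 : ℕ) < c} := by
    rw [Finset.card_eq_sum_card_fiberwise (f := fun x => T x.1 x.2) (t := Finset.univ)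
      (fun _ _ => by simp)]
    refine Finset.sum_congr rfl fun v _ => ?_
    rw [colCount, Finset.filter_filter]
  rw [h1, Finset.card_filter, ← Finset.univ_sigma_univ, Finset.sum_sigma]
  refine Finset.sum_congr rfl fun i _ => ?_
  rw [← Finset.card_filter, Fin.card_filter_val_lt]

theorem colCount_le_wt (T : Tab a n) (v : Fin n) (c : ℕ) : colCount T v c ≤ wt T v := by
  rw [wt_eq_card, colCount]
  refine Finset.card_le_card fun x => ?_
  simp +contextual

/-- The entries in each column are distinct. -/
def ColumnInjective (T : Tab a n) : Prop :=
  ∀ (i j : Fin l) (c : ℕ) (hi : c < a i) (hj : c < a j), T i ⟨c, hi⟩ = T j ⟨c, hj⟩ → i = j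

theorem ColumnInjective.injOn {T : Tab a n} (hT : ColumnInjective T) (v : Fin n) (c : ℕ) :
    Set.InjOn (fun x : Σ i, Fin (a i) => (x.2 : ℕ))
      (({x : Σ i, Fin (a i) | (x.2 : ℕ) < c ∧ T x.1 x.2 = v} : Finset _) : Set _) := by
  rintro ⟨i, d, hd⟩ hx ⟨j, e, he⟩ hy hde
  simp only [Finset.coe_filter, Finset.mem_univ, true_and, Set.mem_ofPred_eq] at hx hy hde
  subst hde
  obtain rfl := hT i j d hd he (hx.2.trans hy.2.symm)
  rfl

theorem ColumnInjective.colCount_le {T : Tab a n} (hT : ColumnInjective T) (v : Fin n) (c : ℕ) :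
    colCount T v c ≤ c := by
  conv_rhs => rw [← Finset.card_range c]
  refine Finset.card_le_card_of_injOn (fun x => (x.2 : ℕ)) ?_ (hT.injOn v c)
  intro x hx
  simpa using (Finset.mem_filter.1 hx).2.1

/-- A value occurs at most once per column, hence at most `min (wt T v) c` times in the first `c`
columns. This is dominance of the weight by the shape. -/
theorem ColumnInjective.sum_min_le {T : Tab a n} (hT : ColumnInjective T) (c : ℕ) :
    ∑ i, min (a i) c ≤ ∑ v, min (wt T v) c := by
  rw [← sum_colCount T]
  exact Finset.sum_le_sum fun v _ => le_min (colCount_le_wt T v c) (hT.colCount_le v c)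

theorem sum_min_wt_diag (a : Fin l → ℕ) (h : l ≤ n) (c : ℕ) :
    ∑ v, min (wt (diag a h) v) c = ∑ i, min (a i) c := by
  symm
  refine Fintype.sum_of_injective (Fin.castLE h) (Fin.castLE_injective h) _ _ ?_ ?_
  · intro v hv
    rw [wt_diag_apply_of_le, Nat.zero_min]
    by_contra hlt
    exact hv ⟨⟨v, not_le.1 hlt⟩, rfl⟩
  · intro i
    rw [wt_diag_apply]

/-- Equality in the dominance bound for every `c` forces each value to fill an initial run of
columns, so a value in column `c + 1` is already in column `c`. -/
theorem ColumnInjective.exists_pred {T : Tab a n} (hT : ColumnInjective T)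
    (hs : ∀ c, ∑ i, min (a i) c = ∑ v, min (wt T v) c) (i : Fin l) (c : ℕ) (hc : c + 1 < a i) :
    ∃ (j : Fin l) (hj : c < a j), T j ⟨c, hj⟩ = T i ⟨c + 1, hc⟩ := by
  have heq : ∀ c v, colCount T v c = min (wt T v) c := by
    intro c v
    have := (Finset.sum_eq_sum_iff_of_le (s := Finset.univ)
      fun v _ => le_min (colCount_le_wt T v c) (hT.colCount_le v c)).1
      ((sum_colCount T c).trans (hs c))
    exact this v (Finset.mem_univ v)
  set v := T i ⟨c + 1, hc⟩ with hv
  have hlt : colCount T v (c + 1) < colCount T v (c + 2) := by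
    refine Finset.card_lt_card (Finset.ssubset_iff_of_subset ?_ |>.2 ?_)
    · intro x
      simp only [Finset.mem_filter, Finset.mem_univ, true_and]
      exact fun h => ⟨by omega, h.2⟩
    · exact ⟨⟨i, c + 1, hc⟩, by simp [← hv], by simp⟩
  rw [heq, heq] at hlt
  have hlt2 : colCount T v c < colCount T v (c + 1) := by
    rw [heq, heq]; omega
  have : ¬ ({x : Σ i, Fin (a i) | (x.2 : ℕ) < c + 1 ∧ T x.1 x.2 = v} : Finset _) ⊆
      ({x : Σ i, Fin (a i) | (x.2 : ℕ) < c ∧ T x.1 x.2 = v} : Finset _) := fun hsub =>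
    absurd (Finset.card_le_card hsub) (not_le.2 hlt2)
  rw [Finset.not_subset] at this
  obtain ⟨⟨j, d, hd⟩, hx, hy⟩ := this
  simp only [Finset.mem_filter, Finset.mem_univ, true_and, not_and] at hx hy
  have hdc : d = c := by
    by_contra hne
    exact hy (by omega) hx.2
  subst hdc
  exact ⟨j, hd, hx.2⟩

theorem le_apply_of_strictMono {f : Fin l → ℕ} (hf : StrictMono f) (i : Fin l) : (i : ℕ) ≤ f i := by
  obtain ⟨i, hi⟩ := i
  induction i with
  | zero => simp
  | succ i ih =>
    have h1 := ih (by omega)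
    have h2 : f ⟨i, by omega⟩ < f ⟨i + 1, hi⟩ := hf (by simp [Fin.lt_def])
    simp only at h1 ⊢
    omega

theorem apply_add_le_of_strictMono {f : Fin l → ℕ} (hf : StrictMono f) {N : ℕ}
    (hN : ∀ i, f i < N) (i : Fin l) : f i + l ≤ N + i := by
  have h0 : ∀ i : Fin l, f i ≤ N := fun i => (hN i).le
  have hg : StrictMono fun i : Fin l => N - 1 - f i.rev := by
    intro i j hij
    have h1 : f j.rev < f i.rev := hf (Fin.rev_lt_rev.2 hij)
    have h2 := hN i.rev
    simp only
    omega
  have h1 := le_apply_of_strictMono hg i.rev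
  have h2 := hN i
  simp only [Fin.rev_rev, Fin.val_rev] at h1
  omega

theorem IsReverse.strictMono_first {T : Tab a n} (h : IsReverse T) (ha : ∀ i, 0 < a i) :
    StrictMono fun i => ((T i ⟨0, ha i⟩ : Fin n) : ℕ) :=
  fun i j hij => h.col i j hij _ _

theorem IsYoung.strictMono_first {T : Tab a n} (h : IsYoung T) (ha : ∀ i, 0 < a i) :
    StrictMono fun i => ((T i ⟨0, ha i⟩ : Fin n) : ℕ) :=
  fun i j hij => h.col i j hij _ _

theorem first_eq {f : Fin l → ℕ} (hf : StrictMono f) (h : ∀ i, f i < l) (i : Fin l) :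
    f i = i := by
  have h1 := le_apply_of_strictMono hf i
  have h2 := apply_add_le_of_strictMono hf h i
  omega

theorem length_le {f : Fin l → ℕ} (hf : StrictMono f) (h : ∀ i, f i < l') : l ≤ l' := by
  by_contra! hl
  have h1 := le_apply_of_strictMono hf ⟨l', hl⟩
  have h2 := h ⟨l', hl⟩
  simp only at h1
  omega

theorem entry_lt_of_wt_eq_diag {T : Tab a n} {h : l' ≤ n} (e : wt T = wt (diag b h)) (i : Fin l)
    (c : Fin (a i)) : (T i c : ℕ) < l' := by
  obtain ⟨j, d, hj⟩ := exists_entry e i c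
  rw [← hj]
  exact j.2

/-- Column by column, and upwards within a column: a wrong entry of row `i` is at most `i`, and by
`exists_pred` it is the value `j < i` of a lower row. If row `j` reaches this column, the value is
repeated there; if not, rows `j` and `i` violate type B. -/
theorem IsReverse.eq_diag {T : Tab a n} (hT : IsReverse T) (ha : ∀ i, 0 < a i) (hl : l ≤ n)
    (hlt : ∀ i c, (T i c : ℕ) < l) (hs : ∀ c, ∑ i, min (a i) c = ∑ v, min (wt T v) c) :
    T = diag a hl := by
  have hinj : ColumnInjective T := fun i j c hi hj => hT.column_injective hi hj
  have key : ∀ (c : ℕ) (i : Fin l) (hc : c < a i), (T i ⟨c, hc⟩ : ℕ) = i := by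
    intro c
    induction c with
    | zero => exact fun i hc => first_eq (hT.strictMono_first ha) (fun i => hlt i _) i
    | succ c ih =>
      intro i
      induction i using WellFoundedLT.induction with
      | ind i ihi =>
        intro hc
        by_contra hne
        obtain ⟨j, hj, hji⟩ := hinj.exists_pred hs i c hc
        have hle : T i ⟨c + 1, hc⟩ ≤ T i ⟨c, by omega⟩ := hT.row i (by simp)
        have hic := ih i (by omega)
        have hjc := ih j hj
        have hle' : (T i ⟨c + 1, hc⟩ : ℕ) ≤ T i ⟨c, by omega⟩ := hle
        have hji' : (T j ⟨c, hj⟩ : ℕ) = T i ⟨c + 1, hc⟩ := by rw [hji]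
        have hlt' : j < i := by rw [Fin.lt_def]; omega
        by_cases hj2 : c + 1 < a j
        · have h1 := ihi j hlt' hj2
          have := hinj j i (c + 1) hj2 hc (Fin.ext (by omega))
          exact hlt'.ne this
        · exact hT.typeB j i hlt' (by omega) c hc hj (by rw [Fin.le_def]; omega) hji.ge
  funext i c
  exact Fin.ext (key c i c.2)

theorem shape_eq {a b : Fin l → ℕ} {hl : l ≤ n} (h : wt (diag a hl) = wt (diag b hl)) :
    a = b := by
  funext i
  rw [← wt_diag_apply a hl, h, wt_diag_apply]

theorem length_eq_of_poly_eq (ha : ∀ i, 0 < a i) (hb : ∀ i, 0 < b i) (hl : l ≤ n) (hl' : l' ≤ n)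
    (h : youngPoly a n = revPoly b n) : l = l' := by
  obtain ⟨U, hU, hUw⟩ : ∃ U : Tab b n, IsReverse U ∧ wt U = wt (diag a hl) := by
    rw [← coeff_revPoly_ne_zero, ← h, coeff_youngPoly_ne_zero]
    exact ⟨_, isYoung_diag a hl, rfl⟩
  obtain ⟨V, hV, hVw⟩ : ∃ V : Tab a n, IsYoung V ∧ wt V = wt (diag b hl') := by
    rw [← coeff_youngPoly_ne_zero, h, coeff_revPoly_ne_zero]
    exact ⟨_, isReverse_diag b hl', rfl⟩
  exact le_antisymm
    (length_le (hV.strictMono_first ha) fun i => entry_lt_of_wt_eq_diag hVw i _)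
    (length_le (hU.strictMono_first hb) fun i => entry_lt_of_wt_eq_diag hUw i _)

theorem shape_eq_of_poly_eq {a b : Fin l → ℕ} (hb : ∀ i, 0 < b i) (hl : l ≤ n)
    (h : youngPoly a n = revPoly b n) : a = b := by
  obtain ⟨U, hU, hUw⟩ : ∃ U : Tab b n, IsReverse U ∧ wt U = wt (diag a hl) := by
    rw [← coeff_revPoly_ne_zero, ← h, coeff_youngPoly_ne_zero]
    exact ⟨_, isYoung_diag a hl, rfl⟩
  obtain ⟨V, hV, hVw⟩ : ∃ V : Tab a n, IsYoung V ∧ wt V = wt (diag b hl) := by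
    rw [← coeff_youngPoly_ne_zero, h, coeff_revPoly_ne_zero]
    exact ⟨_, isReverse_diag b hl, rfl⟩
  -- The dominance bounds for `U` and `V` compare the two shapes in opposite directions.
  have hs : ∀ c, ∑ i, min (b i) c = ∑ v, min (wt U v) c := by
    intro c
    have h1 := ColumnInjective.sum_min_le (T := U) (fun i j c hi hj => hU.column_injective hi hj) c
    have h2 := ColumnInjective.sum_min_le (T := V) (fun i j c hi hj => hV.column_injective hi hj) c
    refine le_antisymm h1 ?_
    rw [hUw, sum_min_wt_diag]
    rwa [hVw, sum_min_wt_diag] at h2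
  have hd := hU.eq_diag hb hl (fun i c => entry_lt_of_wt_eq_diag hUw i c) hs
  rw [hd] at hUw
  exact (shape_eq hUw).symm

theorem sameWeights_of_poly_eq (h : youngPoly a n = revPoly a n) : SameWeights a n := fun w => by
  rw [← coeff_revPoly_ne_zero, ← coeff_youngPoly_ne_zero, h]

end Support

/-! ### Necessity: weights attained by only one kind of tableau -/

section Necessity

variable {l n : ℕ} {a : Fin l → ℕ}

theorem card_filter_lt_of_exists {k : ℕ} {P : Fin k → Prop} [DecidablePred P] (c : Fin k)
    (hc : ¬ P c) : #{d | P d} < k := by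
  conv_rhs => rw [← Fintype.card_fin k, ← Finset.card_univ]
  exact Finset.card_lt_card (Finset.filter_ssubset.2 ⟨c, Finset.mem_univ _, hc⟩)

theorem card_filter_eq_of_forall {k : ℕ} {P : Fin k → Prop} [DecidablePred P]
    (h : ∀ c, P c) : #{d | P d} = k := by
  rw [Finset.filter_true_of_mem fun c _ => h c, Finset.card_univ, Fintype.card_fin]

theorem card_filter_eq_zero_of_forall {k : ℕ} {P : Fin k → Prop} [DecidablePred P]
    (h : ∀ c, ¬ P c) : #{d | P d} = 0 := by
  rw [Finset.filter_false_of_mem fun c _ => h c, Finset.card_empty]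

/-- The filling of shape `a` whose rows are constant with values `r`, except that the last entry
of row `k` is `x`. -/
def modified (a : Fin l → ℕ) (r : Fin l → Fin n) (k : Fin l) (x : Fin n) : Tab a n :=
  fun i c => if i = k ∧ (c : ℕ) + 1 = a k then x else r i

theorem modified_of_ne {r : Fin l → Fin n} {k : Fin l} {x : Fin n} {i : Fin l} (h : i ≠ k)
    (c : Fin (a i)) : modified a r k x i c = r i := by
  simp [modified, h]

theorem modified_of_lt {r : Fin l → Fin n} {k : Fin l} {x : Fin n} {i : Fin l} (c : Fin (a i))
    (h : (c : ℕ) + 1 ≠ a k) : modified a r k x i c = r i := by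
  simp [modified, h]

theorem modified_cases (r : Fin l → Fin n) (k : Fin l) (x : Fin n) (i : Fin l) (c : Fin (a i)) :
    (i = k ∧ (c : ℕ) + 1 = a k ∧ modified a r k x i c = x) ∨ modified a r k x i c = r i := by
  unfold modified
  split_ifs with h
  · exact Or.inl ⟨h.1, h.2, rfl⟩
  · exact Or.inr rfl

/-- The gap of 2 is what makes this work: the changed box and its left neighbour both lie beyond the
end of row `i`, so no triple compares them with that row. -/
theorem isReverse_modified (hl : l ≤ n) (i j : Fin l) (hij : (i : ℕ) + 1 = j)
    (h2 : a i + 2 ≤ a j) : IsReverse (modified a (Fin.castLE hl) j (Fin.castLE hl i)) := by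
  refine ⟨?_, ?_, ?_, ?_⟩
  · intro k c d hcd
    rw [Fin.le_def] at hcd ⊢
    have hd := d.2
    rcases modified_cases (a := a) (Fin.castLE hl) j (Fin.castLE hl i) k c with h | h <;>
    rcases modified_cases (a := a) (Fin.castLE hl) j (Fin.castLE hl i) k d with h' | h'
    · rw [h.2.2, h'.2.2]
    · obtain ⟨rfl, h, -⟩ := h
      have : c = d := Fin.ext (by omega)
      rw [this]
    · rw [h, h'.2.2, h'.1]
      simp only [Fin.val_castLE]; omega
    · rw [h, h']
  · intro p q hpq hp hq
    rw [modified_of_lt, Fin.lt_def]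
    · rcases modified_cases (a := a) (Fin.castLE hl) j (Fin.castLE hl i) q ⟨0, hq⟩ with h | h
      · have := h.2.1
        simp only at this
        omega
      · rw [h]
        exact hpq
    · simp only; omega
  · intro p q hpq hl' c hp hq h3 h4
    rw [Fin.lt_def] at hpq
    rw [Fin.le_def] at h3 h4
    rw [modified_of_lt (i := p) ⟨c, _⟩ (by
      simp only; rintro h
      rcases modified_cases (a := a) (Fin.castLE hl) j (Fin.castLE hl i) q ⟨c + 1, hq⟩ with h' | h'
      · have := h'.2.1; simp only at this; omega
      · rw [h'] at h3 h4
        rcases modified_cases (a := a) (Fin.castLE hl) j (Fin.castLE hl i) p ⟨c, by omega⟩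
          with h'' | h''
        · have := h''.1; subst this; omega
        · rw [h''] at h3; simp only [Fin.val_castLE] at h3; omega)] at h3
    rcases modified_cases (a := a) (Fin.castLE hl) j (Fin.castLE hl i) q ⟨c + 1, hq⟩ with h' | h'
    · rw [h'.2.2] at h3 h4
      obtain rfl := h'.1
      rw [modified_of_ne (by rw [ne_eq, Fin.ext_iff]; omega)] at h4
      simp only [Fin.val_castLE] at h3 h4
      have : p = i := Fin.ext (by omega)
      subst this
      omega
    · rw [h'] at h3
      simp only [Fin.val_castLE] at h3
      omega
  · intro p q hpq hl' c hq hp h3 h4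
    rw [Fin.lt_def] at hpq
    rw [Fin.le_def] at h3 h4
    rcases modified_cases (a := a) (Fin.castLE hl) j (Fin.castLE hl i) q ⟨c + 1, hq⟩ with h' | h'
    · obtain ⟨rfl, h5, h'⟩ := h'
      rw [h', modified_of_ne (by rw [ne_eq, Fin.ext_iff]; omega)] at h4
      simp only [Fin.val_castLE] at h4 h5
      have : p = i := Fin.ext (by omega)
      subst this
      omega
    · rw [h'] at h4
      rcases modified_cases (a := a) (Fin.castLE hl) j (Fin.castLE hl i) p ⟨c, hp⟩ with h'' | h''
      · obtain ⟨rfl, h5, h''⟩ := h''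
        rw [h''] at h4
        simp only [Fin.val_castLE] at h4
        omega
      · rw [h''] at h4
        simp only [Fin.val_castLE] at h4
        omega

/-- A Young tableau with the weight of the modified filling has first column `0, …, l - 1`, so all
boxes in rows from `j` upwards have entries at least `j`. The modified filling has one such entry
fewer. -/
theorem SameWeights.le_add_one (h : SameWeights a n) (ha : ∀ i, 0 < a i) (hl : l ≤ n)
    (i j : Fin l) (hij : (i : ℕ) + 1 = j) : a j ≤ a i + 1 := by
  by_contra! hlt
  obtain ⟨V, hV, hw⟩ := (h _).1 ⟨_, isReverse_modified hl i j hij (by omega), rfl⟩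
  have hlt : ∀ k c, (V k c : ℕ) < l := by
    intro k c
    obtain ⟨k', d, e⟩ := exists_entry hw k c
    rw [← e]
    rcases modified_cases (a := a) (Fin.castLE hl) j (Fin.castLE hl i) k' d with h' | h'
    · rw [h'.2.2]; exact i.2
    · rw [h']; exact k'.2
  have hfirst := first_eq (hV.strictMono_first ha) fun k => hlt k _
  have hc := cnt_congr hw (fun v => (j : ℕ) ≤ v)
  refine absurd hc (ne_of_gt ?_)
  unfold cnt
  refine Finset.sum_lt_sum (fun k _ => ?_) ⟨j, Finset.mem_univ _, ?_⟩
  · rcases lt_or_ge k j with hk | hk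
    · rw [card_filter_eq_zero_of_forall]
      · exact Nat.zero_le _
      · intro c
        rw [modified_of_ne hk.ne]
        exact not_le.2 hk
    · rw [card_filter_eq_of_forall (k := a k) (P := fun c => (j : ℕ) ≤ V k c)]
      · exact (Finset.card_le_univ _).trans_eq (Fintype.card_fin _)
      · intro c
        have h1 : V k ⟨0, ha k⟩ ≤ V k c := hV.row k (by simp [Fin.le_def])
        have h2 := hfirst k
        rw [Fin.le_def] at h1 hk
        omega
  · rw [card_filter_eq_of_forall (k := a j) (P := fun c => (j : ℕ) ≤ V j c)]
    · refine card_filter_lt_of_exists ⟨a j - 1, by omega⟩ ?_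
      rw [modified, if_pos ⟨rfl, by simp only; omega⟩]
      simp only [Fin.val_castLE]
      omega
    · intro c
      have h1 : V j ⟨0, ha j⟩ ≤ V j c := hV.row j (by simp [Fin.le_def])
      have h2 := hfirst j
      rw [Fin.le_def] at h1
      omega

theorem SameWeights.abs_sub_le (h : SameWeights a n) (ha : ∀ i, 0 < a i) (hl : l ≤ n)
    (i j : Fin l) (hij : (i : ℕ) + 1 = j) : |(a i : ℤ) - a j| ≤ 1 := by
  have h1 := h.le_add_one ha hl i j hij
  have h2 := h.rev.le_add_one (fun i => ha _) hl j.rev i.rev (by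
    simp only [Fin.val_rev]; omega)
  simp only [Fin.rev_rev] at h2
  rw [abs_le]
  omega

/-- The entries of the first column that skip the value `i + 2`. -/
def skip (hl : l < n) (i : Fin l) (k : Fin l) : Fin n :=
  ⟨if (k : ℕ) ≤ i + 1 then k else k + 1, by split_ifs <;> omega⟩

/-- The value `i + 2`, absent from the constant rows, is placed only at the end of row `i`. Row `j`
has the smaller value `i + 1`, and rows above `j` have larger values; type II never compares rows
`i` and `j`, since row `j` is longer. -/
theorem isYoung_modified (hl : l < n) (i j : Fin l) (hij : (i : ℕ) + 1 = j) (hi : 2 ≤ a i)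
    (hlt : a i < a j) : IsYoung (modified a (skip hl i) i ⟨i + 2, by omega⟩) := by
  have hr : ∀ k, ((skip hl i k : Fin n) : ℕ) = if (k : ℕ) ≤ i + 1 then (k : ℕ) else k + 1 :=
    fun k => rfl
  refine ⟨?_, ?_, ?_, ?_⟩
  · intro k c d hcd
    rw [Fin.le_def] at hcd ⊢
    have hd := d.2
    rcases modified_cases (a := a) (skip hl i) i ⟨i + 2, by omega⟩ k c with h | h <;>
    rcases modified_cases (a := a) (skip hl i) i ⟨i + 2, by omega⟩ k d with h' | h'
    · rw [h.2.2, h'.2.2]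
    · obtain ⟨rfl, h, -⟩ := h
      have : c = d := Fin.ext (by omega)
      rw [this]
    · have hk : (k : ℕ) = i := congrArg Fin.val h'.1
      rw [h, h'.2.2, hr]
      split_ifs <;> simp only <;> omega
    · rw [h, h']
  · intro p q hpq hp hq
    rw [modified_of_lt, modified_of_lt, Fin.lt_def, hr, hr]
    · rw [Fin.lt_def] at hpq
      split_ifs <;> omega
    · simp only; omega
    · simp only; omega
  · intro p q hpq hl' c hq hp h3 h4
    rw [Fin.lt_def] at hpq
    rw [Fin.le_def] at h3 h4
    rcases modified_cases (a := a) (skip hl i) i ⟨i + 2, by omega⟩ p ⟨c + 1, hp⟩ with h | h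
    · obtain ⟨rfl, h5, h⟩ := h
      rw [h, modified_of_ne (by rw [ne_eq, Fin.ext_iff]; omega), hr] at h3 h4
      split_ifs at h3 h4 <;> simp only at h3 h4 <;> omega
    · rw [h, hr] at h4
      rcases modified_cases (a := a) (skip hl i) i ⟨i + 2, by omega⟩ q ⟨c, by omega⟩ with h' | h'
      · rw [h'.2.2] at h4
        obtain rfl := h'.1
        split_ifs at h4 <;> simp only at h4 <;> omega
      · rw [h', hr] at h4
        split_ifs at h4 <;> omega
  · intro p q hpq hl' c hp hq h3 h4
    rw [Fin.lt_def] at hpq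
    rw [Fin.le_def] at h3 h4
    rcases modified_cases (a := a) (skip hl i) i ⟨i + 2, by omega⟩ p ⟨c + 1, hp⟩ with h | h
    · obtain ⟨rfl, h5, h⟩ := h
      rw [h, modified_of_ne (by rw [ne_eq, Fin.ext_iff]; omega), hr] at h3
      simp only at h5
      have : q ≠ j := by rintro rfl; omega
      rw [ne_eq, Fin.ext_iff] at this
      split_ifs at h3 <;> simp only at h3 <;> omega
    · rw [h, hr] at h3
      rcases modified_cases (a := a) (skip hl i) i ⟨i + 2, by omega⟩ q ⟨c, hq⟩ with h' | h'
      · rw [h'.2.2] at h3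
        obtain rfl := h'.1
        split_ifs at h3 <;> simp only at h3 <;> omega
      · rw [h', hr] at h3
        split_ifs at h3 <;> omega

/-- In a reverse tableau of this weight, counting entries at most `i` forces rows `i` and `j` to
begin with `i + 1` and `i + 2`. As `i + 2` occurs only once, the second entry of row `j` is at most
`i + 1`, against type B. -/
theorem SameWeights.le_of_two_le (h : SameWeights a n) (ha : ∀ i, 0 < a i) (hl : l < n)
    (i j : Fin l) (hij : (i : ℕ) + 1 = j) (hi : 2 ≤ a i) : a j ≤ a i := by
  by_contra! hlt
  obtain ⟨U, hU, hw⟩ := (h _).2 ⟨_, isYoung_modified hl i j hij hi hlt, rfl⟩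
  have hr : ∀ k, ((skip hl i k : Fin n) : ℕ) = if (k : ℕ) ≤ i + 1 then (k : ℕ) else k + 1 :=
    fun k => rfl
  have hUl : ∀ k c, (U k c : ℕ) < l + 1 := by
    intro k c
    obtain ⟨k', d, e⟩ := exists_entry hw k c
    rw [← e]
    rcases modified_cases (a := a) (skip hl i) i ⟨i + 2, by omega⟩ k' d with h' | h'
    · rw [h'.2.2]; simp only; omega
    · rw [h', hr]; split_ifs <;> omega
  -- The entries are among `l + 1` values, so row `k` begins with at most `k + 1`.
  have hup := apply_add_le_of_strictMono (hU.strictMono_first ha) fun k => hUl k _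
  have hmono := hU.strictMono_first ha
  have hi1 : (i : ℕ) < U i ⟨0, ha i⟩ := by
    by_contra! hle
    refine absurd (cnt_congr hw (fun v => (v : ℕ) ≤ i)) (ne_of_gt ?_)
    have hfull : ∀ k ≤ i, #{c | ((U k c : Fin n) : ℕ) ≤ i} = a k := by
      intro k hk
      refine card_filter_eq_of_forall fun c => ?_
      have h1 : U k c ≤ U k ⟨0, ha k⟩ := hU.row k (by simp [Fin.le_def])
      have h2 : (U k ⟨0, ha k⟩ : ℕ) ≤ U i ⟨0, ha i⟩ := hmono.monotone hk
      rw [Fin.le_def] at h1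
      omega
    unfold cnt
    refine Finset.sum_lt_sum (fun k _ => ?_) ⟨i, Finset.mem_univ _, ?_⟩
    · rcases le_or_gt k i with hk | hk
      · rw [hfull k hk]
        exact (Finset.card_le_univ _).trans_eq (Fintype.card_fin _)
      · rw [card_filter_eq_zero_of_forall]
        · exact Nat.zero_le _
        · intro c
          rw [modified_of_ne hk.ne']
          rw [Fin.lt_def] at hk
          simp only [hr]
          split_ifs <;> omega
    · rw [hfull i le_rfl]
      refine card_filter_lt_of_exists ⟨a i - 1, by omega⟩ ?_
      rw [modified, if_pos ⟨rfl, by simp only; omega⟩]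
      simp only
      omega
  have hi2 : (U i ⟨0, ha i⟩ : ℕ) = i + 1 := by have := hup i; omega
  have hj2 : (U j ⟨0, ha j⟩ : ℕ) = i + 2 := by
    have h1 := hup j
    have h2 : (U i ⟨0, ha i⟩ : ℕ) < U j ⟨0, ha j⟩ := hmono (by rw [Fin.lt_def]; omega)
    omega
  have hne : (U j ⟨1, by omega⟩ : ℕ) ≠ i + 2 := by
    intro hj3
    refine absurd (cnt_congr hw (fun v => (v : ℕ) = i + 2)) (ne_of_gt ?_)
    have h1 : cnt (modified a (skip hl i) i ⟨i + 2, by omega⟩) (fun v => (v : ℕ) = i + 2) ≤ 1 := by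
      unfold cnt
      rw [Finset.sum_eq_single i]
      · rw [Finset.card_le_one]
        intro c hc d hd
        simp only [Finset.mem_filter, Finset.mem_univ, true_and] at hc hd
        rcases modified_cases (a := a) (skip hl i) i ⟨i + 2, by omega⟩ i c with h | h
        · rcases modified_cases (a := a) (skip hl i) i ⟨i + 2, by omega⟩ i d with h' | h'
          · exact Fin.ext (by omega)
          · rw [h', hr] at hd; split_ifs at hd <;> omega
        · rw [h, hr] at hc; split_ifs at hc <;> omega
      · intro k _ hk
        refine card_filter_eq_zero_of_forall fun c => ?_
        rw [modified_of_ne hk]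
        simp only [hr]
        split_ifs <;> omega
      · simp
    refine lt_of_le_of_lt h1 ?_
    unfold cnt
    refine lt_of_lt_of_le ?_ (Finset.single_le_sum (fun _ _ => Nat.zero_le _) (Finset.mem_univ j))
    rw [Finset.one_lt_card]
    exact ⟨⟨0, ha j⟩, by simp [hj2], ⟨1, by omega⟩, by simp [hj3], by simp⟩
  have hle : U j ⟨1, by omega⟩ ≤ U j ⟨0, ha j⟩ := hU.row j (by simp)
  rw [Fin.le_def] at hle
  exact hU.typeB i j (by rw [Fin.lt_def]; omega) hlt 0 (by omega) (ha i)
    (by rw [Fin.le_def]; omega) (by rw [Fin.le_def]; simp only [zero_add]; omega)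

theorem SameWeights.eq_of_two_le (h : SameWeights a n) (ha : ∀ i, 0 < a i) (hl : l < n)
    (i j : Fin l) (hij : (i : ℕ) + 1 = j) (hi : 2 ≤ a i) (hj : 2 ≤ a j) : a i = a j := by
  have h1 := h.le_of_two_le ha hl i j hij hi
  have h2 := h.rev.le_of_two_le (fun i => ha _) hl j.rev i.rev (by
    simp only [Fin.val_rev]; omega) (by simpa only [Fin.rev_rev] using hj)
  simp only [Fin.rev_rev] at h2
  omega

theorem SameWeights.conditions (h : SameWeights a n) (ha : ∀ i, 0 < a i) (hl : l ≤ n) :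
    (∀ i j, a i = a j) ∨ (∀ i, a i = 1 ∨ a i = 2) ∨
      (n = l ∧ ∀ i j : Fin l, (i : ℕ) + 1 = j → |(a i : ℤ) - a j| ≤ 1) := by
  have hd := h.abs_sub_le ha hl
  rcases hl.eq_or_lt with rfl | hl'
  · exact Or.inr (Or.inr ⟨rfl, hd⟩)
  by_cases h3 : ∃ k, 3 ≤ a k
  · obtain ⟨k, hk⟩ := h3
    -- A neighbour of a part at least 3 is at least 2, hence equal to it, so this value spreads to
    -- all rows.
    have hstep : ∀ i j : Fin l, (i : ℕ) + 1 = j → (a i = a k ↔ a j = a k) := by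
      intro i j hij
      have h1 := abs_le.1 (hd i j hij)
      have h2 := h.eq_of_two_le ha hl' i j hij
      omega
    have hzero : ∀ (m : ℕ) (hm : m < l), (a ⟨m, hm⟩ = a k ↔ a ⟨0, by omega⟩ = a k) := by
      intro m
      induction m with
      | zero => intro hm; rfl
      | succ m ih => intro hm; rw [← ih (by omega)]; exact (hstep _ _ rfl).symm
    have hall : ∀ i, a i = a k := fun i => (hzero i i.2).2 ((hzero k k.2).1 rfl)
    exact Or.inl fun i j => (hall i).trans (hall j).symm
  · push Not at h3
    refine Or.inr (Or.inl fun i => ?_)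
    have := h3 i
    have := ha i
    omega

end Necessity

/-! ### As many variables as rows: uniqueness of the tableau -/

section FullLength

variable {l : ℕ} {a : Fin l → ℕ}

/-- A discrete intermediate value theorem for the parts. -/
theorem exists_between (hd : ∀ i j : Fin l, (i : ℕ) + 1 = j → |(a i : ℤ) - a j| ≤ 1)
    {c : ℕ} (i j : Fin l) (hij : i ≤ j) (hi : a i ≤ c) (hj : c ≤ a j) :
    ∃ k, i ≤ k ∧ k ≤ j ∧ a k = c := by
  obtain ⟨j, hjl⟩ := j
  induction j with
  | zero => exact ⟨i, le_rfl, hij, by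
      have : i = ⟨0, hjl⟩ := Fin.le_antisymm hij (by simp [Fin.le_def])
      rw [← this] at hj; omega⟩
  | succ j ih =>
    rcases hij.eq_or_lt with rfl | hlt
    · exact ⟨_, le_rfl, le_rfl, by omega⟩
    · have h1 := abs_le.1 (hd ⟨j, by omega⟩ ⟨j + 1, hjl⟩ rfl)
      rcases le_or_gt c (a ⟨j, by omega⟩) with hc | hc
      · obtain ⟨k, h2, h3, h4⟩ := ih (by omega)
          (by rw [Fin.lt_def] at hlt; rw [Fin.le_def]; simp only at hlt ⊢; omega) hc
        exact ⟨k, h2, h3.trans (by simp [Fin.le_def]), h4⟩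
      · exact ⟨_, hij, le_rfl, by omega⟩

/-- The first column is forced. By induction on rows, a first wrong entry `v < j` in row `j` is also
the constant value of row `v`. Either row `v` reaches that column and gives a bad triple, or some
row `k` between `v` and `j` ends just before it, and its value `k` violates type B. -/
theorem IsReverse.eq_diag_of_full {T : Tab a l} (hT : IsReverse T) (ha : ∀ i, 0 < a i)
    (hd : ∀ i j : Fin l, (i : ℕ) + 1 = j → |(a i : ℤ) - a j| ≤ 1) : T = diag a le_rfl := by
  have hfirst := first_eq (hT.strictMono_first ha) fun i => (T i _).2
  have key : ∀ (j : Fin l) (c : ℕ) (hc : c < a j), T j ⟨c, hc⟩ = j := by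
    intro j
    induction j using WellFoundedLT.induction with
    | ind j ihj =>
      intro c
      induction c with
      | zero => exact fun hc => Fin.ext (hfirst j)
      | succ c ihc =>
        intro hc
        have hjc := ihc (by omega)
        have hle : T j ⟨c + 1, hc⟩ ≤ T j ⟨c, by omega⟩ := hT.row j (by simp)
        rw [hjc] at hle
        rcases hle.eq_or_lt with h | hlt
        · exact h
        exfalso
        -- Entries and row indices both range over `Fin l`, so `v` also names a row.
        set v := T j ⟨c + 1, hc⟩ with hv
        by_cases hvc : c + 1 < a v
        · rcases le_or_gt (a j) (a v) with hav | hav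
          · refine hT.typeA v j hlt hav c hvc hc ?_ ?_
            · rw [ihj v hlt]
            · rw [ihj v hlt]
          · refine hT.typeB v j hlt hav c hc (by omega) ?_ ?_
            · rw [ihj v hlt, hjc]; exact hlt.le
            · rw [ihj v hlt]
        · obtain ⟨k, hvk, hkj, hk⟩ := exists_between hd (c := c + 1) v j hlt.le (by omega) hc.le
          have hkj' : k < j := lt_of_le_of_ne hkj (by rintro rfl; omega)
          refine hT.typeB k j hkj' (by omega) c hc (by omega) ?_ ?_
          · rw [ihj k hkj', hjc]; exact hkj
          · rw [ihj k hkj']; exact hvk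
  funext i c
  exact key i c c.2

theorem youngPoly_eq_revPoly_of_full (ha : ∀ i, 0 < a i)
    (hd : ∀ i j : Fin l, (i : ℕ) + 1 = j → |(a i : ℤ) - a j| ≤ 1) :
    youngPoly a l = revPoly a l := by
  classical
  have h1 : ∀ T : Tab a l, IsReverse T ↔ T = diag a le_rfl := fun T =>
    ⟨fun h => h.eq_diag_of_full ha hd, by rintro rfl; exact isReverse_diag a _⟩
  have h2 : ∀ T : Tab a l, IsYoung T ↔ T = diag a le_rfl := fun T => by
    refine ⟨fun h => rotate_bijective.1 ?_, by rintro rfl; exact isYoung_diag a _⟩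
    have hd' : ∀ i j : Fin l, (i : ℕ) + 1 = j → |(a i.rev : ℤ) - a j.rev| ≤ 1 := by
      intro i j hij
      rw [abs_sub_comm]
      exact hd j.rev i.rev (by simp only [Fin.val_rev]; omega)
    rw [(isReverse_rotate.2 h).eq_diag_of_full (fun i => ha _) hd',
      (isReverse_rotate.2 (isYoung_diag a le_rfl)).eq_diag_of_full (fun i => ha _) hd']
  unfold youngPoly revPoly
  simp only [h1, h2]

end FullLength

/-! ### Adjacent columns and their sets of entries -/

section Columns

variable {l n : ℕ}

/-- The condition on adjacent columns `f`, `g` of a rectangular reverse composition tableau. -/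
structure Step (f g : Fin l → Fin n) : Prop where
  le : ∀ i, g i ≤ f i
  inversion : ∀ i j, i < j → g j ≤ f i → ¬ g i ≤ g j

/-- For each bound, `D` has at least as many elements below it as `C`. -/
def Dominated (C D : Finset (Fin n)) : Prop :=
  ∀ v : ℕ, #{x ∈ C | x.val < v} ≤ #{x ∈ D | x.val < v}

theorem card_filter_image {f : Fin l → Fin n} (hf : Function.Injective f) (P : Fin n → Prop)
    [DecidablePred P] : #{x ∈ univ.image f | P x} = #{i | P (f i)} := by
  rw [Finset.filter_image, Finset.card_image_of_injective _ hf]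

theorem card_univ_image {f : Fin l → Fin n} (hf : Function.Injective f) :
    #(univ.image f) = l := by
  rw [Finset.card_image_of_injective _ hf, Finset.card_univ, Fintype.card_fin]

theorem Step.injective {f g : Fin l → Fin n} (h : Step f g) : Function.Injective g := by
  suffices key : ∀ i j, i < j → g i ≠ g j by
    intro i j e
    by_contra hne
    rcases lt_or_gt_of_ne hne with hij | hij
    · exact key i j hij e
    · exact key j i hij e.symm
  intro i j hij e
  exact h.inversion i j hij (e ▸ h.le i) e.le

theorem Step.dominated {f g : Fin l → Fin n} (h : Step f g) (hf : Function.Injective f) :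
    Dominated (univ.image f) (univ.image g) := by
  intro v
  rw [card_filter_image hf, card_filter_image h.injective]
  refine Finset.card_le_card (Finset.monotone_filter_right _ fun i _ hi => ?_)
  exact lt_of_le_of_lt (h.le i) hi

/-- Each row must take the largest value at most `f i` not used below it. At the first disagreement,
the larger candidate appears higher up in the other column and creates a forbidden triple. -/
theorem Step.unique {f g g' : Fin l → Fin n} (h : Step f g) (h' : Step f g')
    (e : univ.image g = univ.image g') : g = g' := by
  suffices key : ∀ g g' : Fin l → Fin n, Step f g → Step f g' → univ.image g = univ.image g' →
      ∀ i, (∀ j < i, g j = g' j) → ¬ g i < g' i by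
    funext i
    induction i using WellFoundedLT.induction with
    | ind i ih =>
      exact le_antisymm (not_lt.1 (key g' g h' h e.symm i fun j hj => (ih j hj).symm))
        (not_lt.1 (key g g' h h' e i ih))
  intro g g' h h' e i ih hlt
  have hmem : g' i ∈ univ.image g := e ▸ Finset.mem_image_of_mem _ (Finset.mem_univ i)
  obtain ⟨k, -, hk⟩ := Finset.mem_image.1 hmem
  rcases lt_trichotomy k i with hki | rfl | hki
  · exact hki.ne (h'.injective ((ih k hki).symm.trans hk))
  · exact hlt.ne hk
  · exact h.inversion i k hki (hk ▸ h'.le i) (hk ▸ hlt.le)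

/-- Greedy construction from the bottom: row 0 takes the largest `m ∈ C` with `m ≤ f 0`, and the
counting condition survives the removal of `f 0` and `m`. -/
theorem exists_step : ∀ {l : ℕ} (f : Fin l → Fin n) (C : Finset (Fin n)), #C = l →
    (∀ v : ℕ, #{i | (f i : ℕ) < v} ≤ #{x ∈ C | x.val < v}) →
    ∃ g, Step f g ∧ univ.image g = C := by
  intro l
  induction l with
  | zero =>
    intro f C hC _
    refine ⟨f, ⟨fun i => i.elim0, fun i => i.elim0⟩, ?_⟩
    rw [Finset.card_eq_zero.1 hC]
    rfl
  | succ l ih =>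
    intro f C hC hdom
    have hsplit : ∀ v : ℕ, #{i | (f i : ℕ) < v} =
        (if (f 0 : ℕ) < v then 1 else 0) + #{i : Fin l | (f i.succ : ℕ) < v} := by
      intro v
      simp only [Finset.card_filter, Fin.sum_univ_succ]
    have hne : ({x ∈ C | x ≤ f 0} : Finset (Fin n)).Nonempty := by
      rw [← Finset.card_pos]
      have h1 := hdom (f 0 + 1)
      rw [hsplit, if_pos (Nat.lt_succ_self _)] at h1
      have h2 : ({x ∈ C | x.val < f 0 + 1} : Finset (Fin n)) = {x ∈ C | x ≤ f 0} :=
        Finset.filter_congr fun x _ => by rw [Fin.le_def]; omega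
      rw [h2] at h1
      omega
    obtain ⟨m, hm, hmax⟩ : ∃ m ∈ ({x ∈ C | x ≤ f 0} : Finset (Fin n)),
        ∀ x ∈ ({x ∈ C | x ≤ f 0} : Finset (Fin n)), x ≤ m :=
      ⟨_, Finset.max'_mem _ hne, fun x hx => Finset.le_max' _ x hx⟩
    simp only [Finset.mem_filter, and_imp] at hm hmax
    obtain ⟨hmC, hm0⟩ := hm
    obtain ⟨g, hg, hgC⟩ := ih (fun i => f i.succ) (C.erase m)
      (by rw [Finset.card_erase_of_mem hmC, hC]; rfl) (by
        intro v
        have h1 := hdom v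
        rw [hsplit] at h1
        rw [Finset.filter_erase]
        rw [Fin.le_def] at hm0
        by_cases hmv : (m : ℕ) < v
        · rw [Finset.card_erase_of_mem (by simp [hmC, hmv])]
          by_cases h0 : (f 0 : ℕ) < v
          · rw [if_pos h0] at h1
            omega
          -- Here `m < v ≤ f 0`. By maximality `C` has no element strictly between `m` and `f 0 +
          -- 1`, so the bound at `f 0 + 1`, which also counts row 0, has one to spare.
          · have h2 := hdom (f 0 + 1)
            rw [hsplit, if_pos (Nat.lt_succ_self _)] at h2
            have h3 : #{i : Fin l | (f i.succ : ℕ) < v} ≤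
                #{i : Fin l | (f i.succ : ℕ) < f 0 + 1} :=
              Finset.card_le_card (Finset.monotone_filter_right _ fun i _ hi =>
                lt_of_lt_of_le hi (by omega))
            have h4 : ({x ∈ C | x.val < f 0 + 1} : Finset (Fin n)) = {x ∈ C | x.val < v} := by
              refine Finset.filter_congr fun x hx => ⟨fun h => ?_, fun h => by omega⟩
              have := hmax x hx (by rw [Fin.le_def]; omega)
              rw [Fin.le_def] at this
              omega
            rw [h4] at h2
            omega
        · rw [Finset.erase_eq_of_notMem (by simp [hmv])]
          omega)
    have hgm : ∀ j, g j ∈ C ∧ g j ≠ m := by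
      intro j
      have : g j ∈ C.erase m := hgC ▸ Finset.mem_image_of_mem _ (Finset.mem_univ j)
      rw [Finset.mem_erase] at this
      exact this.symm
    refine ⟨Fin.cons m g, ⟨?_, ?_⟩, ?_⟩
    · intro i
      refine Fin.cases ?_ (fun i => ?_) i
      · simpa using hm0
      · simpa using hg.le i
    · intro i j hij
      obtain ⟨j, rfl⟩ := Fin.exists_succ_eq_of_ne_zero (Fin.ne_zero_of_lt hij)
      revert hij
      refine Fin.cases ?_ (fun i => ?_) i
      · intro _ h1 h2
        simp only [Fin.cons_succ, Fin.cons_zero] at h1 h2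
        exact (hgm j).2 (le_antisymm (hmax _ (hgm j).1 h1) h2)
      · intro hij
        simpa using hg.inversion i j (Fin.succ_lt_succ_iff.1 hij)
    · ext x
      have hx : x ∈ univ.image g ↔ x ∈ C.erase m := by rw [hgC]
      simp only [Finset.mem_image, Finset.mem_univ, true_and, Finset.mem_erase] at hx
      simp only [Finset.mem_image, Finset.mem_univ, true_and, Fin.exists_fin_succ, Fin.cons_zero,
        Fin.cons_succ, hx]
      constructor
      · rintro (rfl | h)
        · exact hmC
        · exact h.2
      · intro h
        by_cases hxm : m = x
        · exact Or.inl hxm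
        · exact Or.inr ⟨Ne.symm hxm, h⟩

theorem exists_step_of_dominated {f : Fin l → Fin n} (hf : Function.Injective f)
    {C : Finset (Fin n)} (hC : #C = l) (h : Dominated (univ.image f) C) :
    ∃ g, Step f g ∧ univ.image g = C :=
  exists_step f C hC fun v => by rw [← card_filter_image hf fun x => (x : ℕ) < v]; exact h v

theorem exists_strictMono {C : Finset (Fin n)} (hC : #C = l) :
    ∃ f : Fin l → Fin n, StrictMono f ∧ univ.image f = C :=
  ⟨C.orderEmbOfFin hC, (C.orderEmbOfFin hC).strictMono, by simp⟩

theorem strictMono_unique {f g : Fin l → Fin n} (hf : StrictMono f) (hg : StrictMono g)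
    (h : univ.image f = univ.image g) : f = g := by
  refine hf.range_inj hg |>.1 ?_
  simpa using congrArg (fun s : Finset (Fin n) => (s : Set (Fin n))) h

/-- The image of a set of entries under complementation. -/
def compl (C : Finset (Fin n)) : Finset (Fin n) := C.map Fin.revPerm.toEmbedding

theorem mem_compl {C : Finset (Fin n)} {v : Fin n} : v ∈ compl C ↔ v.rev ∈ C := by
  simp [compl]

theorem compl_compl (C : Finset (Fin n)) : compl (compl C) = C := by
  ext v
  simp [mem_compl]

theorem card_compl (C : Finset (Fin n)) : #(compl C) = #C := Finset.card_map _

theorem card_filter_compl (C : Finset (Fin n)) (P : Fin n → Prop) [DecidablePred P] :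
    #{x ∈ compl C | P x} = #{x ∈ C | P x.rev} := by
  rw [compl, Finset.filter_map, Finset.card_map]
  rfl

/-- With equal cardinalities, more small elements means fewer large ones, and complementation
exchanges small and large. -/
theorem Dominated.compl {C D : Finset (Fin n)} (h : Dominated C D) (hCD : #C = #D) :
    Dominated (compl D) (compl C) := by
  intro v
  rw [card_filter_compl, card_filter_compl]
  have key : ∀ C : Finset (Fin n),
      #{x ∈ C | x.val < n - v} + #{x ∈ C | x.rev.val < v} = #C := by
    intro C
    rw [← Finset.card_filter_add_card_filter_not (s := C) fun x : Fin n => (x : ℕ) < n - v]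
    congr 2
    refine Finset.filter_congr fun x _ => ?_
    rw [Fin.val_rev]
    omega
  have h1 := key C
  have h2 := key D
  have h3 := h (n - v)
  omega

theorem sum_single_compl (C : Finset (Fin n)) :
    (∑ v ∈ compl C, Finsupp.single v 1 : Fin n →₀ ℕ) =
      Finsupp.mapDomain Fin.rev (∑ v ∈ C, Finsupp.single v 1) := by
  rw [compl, Finset.sum_map, Finsupp.mapDomain_finsetSum]
  simp [Finsupp.mapDomain_single]

end Columns

/-! ### All parts equal: chains of column sets -/

section Rectangle

variable {l n p : ℕ}

/-- The possible sequences of column sets of a rectangular reverse composition tableau. -/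
def IsChain (l : ℕ) (C : Fin p → Finset (Fin n)) : Prop :=
  (∀ c, #(C c) = l) ∧
    ∀ (c : ℕ) (h : c + 1 < p), Dominated (C ⟨c, Nat.lt_of_succ_lt h⟩) (C ⟨c + 1, h⟩)

/-- The set of entries of a column of a rectangular filling. -/
def colSet (T : Tab (fun _ : Fin l => p) n) (c : Fin p) : Finset (Fin n) :=
  univ.image fun i => T i c

theorem IsReverse.step {T : Tab (fun _ : Fin l => p) n} (h : IsReverse T) (c : ℕ)
    (hc : c + 1 < p) : Step (fun i => T i ⟨c, Nat.lt_of_succ_lt hc⟩) fun i => T i ⟨c + 1, hc⟩ :=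
  ⟨fun i => h.row i (by simp), fun i j hij => h.typeA i j hij le_rfl c hc hc⟩

theorem IsReverse.injective_col {T : Tab (fun _ : Fin l => p) n} (h : IsReverse T) (c : Fin p) :
    Function.Injective fun i => T i c := fun _ _ e => h.column_injective c.2 c.2 e

theorem IsReverse.isChain {T : Tab (fun _ : Fin l => p) n} (h : IsReverse T) :
    IsChain l (colSet T) :=
  ⟨fun c => card_univ_image (h.injective_col c),
    fun c hc => (h.step c hc).dominated (h.injective_col _)⟩

/-- The first column is its set in increasing order; each later column follows by `Step.unique`. -/
theorem IsReverse.eq_of_colSet_eq {T U : Tab (fun _ : Fin l => p) n} (hT : IsReverse T)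
    (hU : IsReverse U) (h : colSet T = colSet U) : T = U := by
  have key : ∀ (c : ℕ) (hc : c < p), (fun i => T i ⟨c, hc⟩) = fun i => U i ⟨c, hc⟩ := by
    intro c
    induction c with
    | zero =>
      exact fun hc => strictMono_unique (fun i j hij => hT.col i j hij hc hc)
        (fun i j hij => hU.col i j hij hc hc) (congrFun h ⟨0, hc⟩)
    | succ c ih =>
      intro hc
      have h1 := hT.step c hc
      rw [ih] at h1
      exact h1.unique (hU.step c hc) (congrFun h ⟨c + 1, hc⟩)
  funext i c
  exact congrFun (key c c.2) i

theorem IsChain.exists_isReverse {C : Fin p → Finset (Fin n)} (h : IsChain l C) :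
    ∃ T : Tab (fun _ : Fin l => p) n, IsReverse T ∧ colSet T = C := by
  rcases Nat.eq_zero_or_pos p with rfl | hp
  · exact ⟨fun _ c => c.elim0, ⟨fun _ c => c.elim0, fun _ _ _ h => absurd h (lt_irrefl _),
      fun _ _ _ _ _ h => absurd h (Nat.not_lt_zero _),
      fun _ _ _ _ _ h => absurd h (Nat.not_lt_zero _)⟩, funext fun c => c.elim0⟩
  -- The hypotheses sit under the existential so that `choose` gives a total function, which can be
  -- iterated; `f` is a dummy value when they fail.
  have hex : ∀ (f : Fin l → Fin n) (D : Finset (Fin n)), ∃ g : Fin l → Fin n,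
      Function.Injective f → #D = l → Dominated (univ.image f) D →
        Step f g ∧ univ.image g = D := by
    intro f D
    by_cases hc : Function.Injective f ∧ #D = l ∧ Dominated (univ.image f) D
    · obtain ⟨g, hg⟩ := exists_step_of_dominated hc.1 hc.2.1 hc.2.2
      exact ⟨g, fun _ _ _ => hg⟩
    · exact ⟨f, fun h1 h2 h3 => absurd ⟨h1, h2, h3⟩ hc⟩
  choose G hG using hex
  obtain ⟨f, hf, hfC⟩ := exists_strictMono (h.1 ⟨0, hp⟩)
  let E : ℕ → Finset (Fin n) := fun c => if hc : c < p then C ⟨c, hc⟩ else ∅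
  have hE : ∀ c (hc : c < p), E c = C ⟨c, hc⟩ := fun c hc => dif_pos hc
  let col : ℕ → Fin l → Fin n := fun c => Nat.rec f (fun c g => G g (E (c + 1))) c
  have hsucc : ∀ c, col (c + 1) = G (col c) (E (c + 1)) := fun _ => rfl
  have hcol : ∀ c (hc : c < p), Function.Injective (col c) ∧ univ.image (col c) = C ⟨c, hc⟩ := by
    intro c
    induction c with
    | zero => exact fun hc => ⟨hf.injective, hfC⟩
    | succ c ih =>
      intro hc
      obtain ⟨h1, h2⟩ := ih (by omega)
      have h3 := hG (col c) (E (c + 1)) h1 (by rw [hE _ hc]; exact h.1 _)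
        (by rw [hE _ hc, h2]; exact h.2 c hc)
      rw [← hsucc] at h3
      exact ⟨h3.1.injective, by rw [h3.2, hE _ hc]⟩
  have hstep : ∀ c, c + 1 < p → Step (col c) (col (c + 1)) := by
    intro c hc
    obtain ⟨h1, h2⟩ := hcol c (by omega)
    have h3 := hG (col c) (E (c + 1)) h1 (by rw [hE _ hc]; exact h.1 _)
      (by rw [hE _ hc, h2]; exact h.2 c hc)
    exact h3.1
  have hrev : ∀ T : Tab (fun _ : Fin l => p) n, (∀ i c, T i c = col c i) → IsReverse T := by
    intro T hT
    refine ⟨?_, ?_, ?_, ?_⟩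
    · rintro i ⟨c, hc⟩ ⟨d, hd⟩ hcd
      rw [hT, hT]
      change c ≤ d at hcd
      simp only
      induction d, hcd using Nat.le_induction with
      | base => exact le_rfl
      | succ d _ ih => exact ((hstep d hd).le i).trans (ih (Nat.lt_of_succ_lt hd))
    · intro i j hij _ _
      rw [hT, hT]
      exact hf hij
    · intro i j hij _ c hc _
      rw [hT, hT, hT]
      exact (hstep c hc).inversion i j hij
    · exact fun i j _ h => absurd h (lt_irrefl _)
  refine ⟨fun i c => col c i, hrev _ fun _ _ => rfl, ?_⟩
  funext c
  exact (hcol c c.2).2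

theorem IsReverse.wt_eq {T : Tab (fun _ : Fin l => p) n} (h : IsReverse T) :
    wt T = ∑ c, ∑ v ∈ colSet T c, Finsupp.single v 1 := by
  rw [wt, Finset.sum_comm]
  refine Finset.sum_congr rfl fun c _ => ?_
  rw [colSet, Finset.sum_image fun i _ j _ e => h.injective_col c e]

open Classical in
theorem revPoly_rectangle (l p n : ℕ) : revPoly (fun _ : Fin l => p) n =
    ∑ C : Fin p → Finset (Fin n) with IsChain l C,
      MvPolynomial.monomial (∑ c, ∑ v ∈ C c, Finsupp.single v 1) 1 := by
  unfold revPoly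
  refine Finset.sum_bij (fun T _ => colSet T) ?_ ?_ ?_ ?_
  · intro T hT
    simpa using IsReverse.isChain (by simpa using hT)
  · intro T hT U hU e
    exact IsReverse.eq_of_colSet_eq (by simpa using hT) (by simpa using hU) e
  · intro C hC
    obtain ⟨T, hT, e⟩ := IsChain.exists_isReverse (l := l) (by simpa using hC)
    exact ⟨T, by simpa using hT, e⟩
  · intro T hT
    rw [IsReverse.wt_eq (by simpa using hT)]

theorem IsChain.rev {C : Fin p → Finset (Fin n)} (h : IsChain l C) :
    IsChain l fun c => compl (C c.rev) := by
  refine ⟨fun c => by rw [card_compl, h.1], fun c hc => ?_⟩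
  refine Dominated.compl ?_ (by rw [h.1, h.1])
  have h1 := h.2 (p - 1 - (c + 1)) (by omega)
  convert h1 using 2
  · ext; simp only [Fin.val_rev]; omega
  · ext; simp only [Fin.val_rev]; omega

/-- Complementing every column set and reversing their order is an involution on chains, and it
reverses the variables in the weight. -/
theorem rename_rev_revPoly_rectangle (l p n : ℕ) :
    MvPolynomial.rename Fin.rev (revPoly (fun _ : Fin l => p) n) =
      revPoly (fun _ : Fin l => p) n := by
  classical
  rw [revPoly_rectangle, map_sum]
  refine Finset.sum_bij (fun C _ c => compl (C c.rev)) ?_ ?_ ?_ ?_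
  · intro C hC
    simpa using IsChain.rev (by simpa using hC)
  · intro C _ D _ e
    funext c
    have := congrArg compl (congrFun e c.rev)
    simpa only [compl_compl, Fin.rev_rev] using this
  · intro C hC
    refine ⟨fun c => compl (C c.rev), by simpa using IsChain.rev (by simpa using hC), ?_⟩
    funext c
    simp only [compl_compl, Fin.rev_rev]
  · intro C _
    rw [MvPolynomial.rename_monomial]
    rw [Finsupp.mapDomain_finsetSum]
    simp only [sum_single_compl]
    refine congrArg (fun w => MvPolynomial.monomial w (1 : ℤ)) ?_
    exact (Equiv.sum_comp Fin.revPerm fun c =>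
      Finsupp.mapDomain Fin.rev (∑ v ∈ C c, Finsupp.single v 1)).symm

theorem youngPoly_rectangle (l p n : ℕ) :
    youngPoly (fun _ : Fin l => p) n = revPoly (fun _ : Fin l => p) n := by
  refine MvPolynomial.rename_injective _ Fin.rev_injective ?_
  rw [rename_rev_youngPoly, rename_rev_revPoly_rectangle]

end Rectangle

/-! ### Parts 1 and 2: pairs of column sets -/

section TwoColumns

variable {l n : ℕ} {a : Fin l → ℕ}

/-- The element of rank `k` is the same in `C` and in `D`. -/
def Agree (C D : Finset (Fin n)) (k : ℕ) (v : Fin n) : Prop :=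
  v ∈ C ∧ v ∈ D ∧ #{x ∈ C | x < v} = k ∧ #{x ∈ D | x < v} = k

theorem Agree.compl {C D : Finset (Fin n)} {v : Fin n} {i : Fin l} (h : Agree C D i v)
    (hC : #C = l) (hD : #D = l) : Agree (compl D) (compl C) i.rev v.rev := by
  have key : ∀ C : Finset (Fin n), v ∈ C → #{x ∈ C | x < v} = i → #C = l →
      #{x ∈ QSchur.compl C | x < v.rev} = (i.rev : ℕ) := by
    intro C hv hi hC
    rw [card_filter_compl]
    have h1 := Finset.card_filter_add_card_filter_not (s := C) fun x : Fin n => x < v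
    have h2 : ({x ∈ C | ¬ x < v} : Finset (Fin n)) = insert v {x ∈ C | x.rev < v.rev} := by
      ext x
      simp only [Finset.mem_filter, Finset.mem_insert, not_lt, Fin.rev_lt_rev]
      constructor
      · rintro ⟨h3, h4⟩
        rcases h4.eq_or_lt with rfl | h4
        · exact Or.inl rfl
        · exact Or.inr ⟨h3, h4⟩
      · rintro (rfl | h3)
        · exact ⟨hv, le_rfl⟩
        · exact ⟨h3.1, h3.2.le⟩
    rw [h2, Finset.card_insert_of_notMem (by simp)] at h1
    rw [Fin.val_rev]
    omega
  exact ⟨by simpa [mem_compl] using h.2.1, by simpa [mem_compl] using h.1,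
    key D h.2.1 h.2.2.2 hD, key C h.1 h.2.2.1 hC⟩

/-- The possible column sets of a reverse composition tableau whose parts are `1` or `2`, when
each row of length `1` is prolonged by a copy of its entry. -/
structure IsPair (a : Fin l → ℕ) (P : Finset (Fin n) × Finset (Fin n)) : Prop where
  card_fst : #P.1 = l
  card_snd : #P.2 = l
  dominated : Dominated P.1 P.2
  agree : ∀ i, a i = 1 → ∃ v, Agree P.1 P.2 i v

open Classical in
/-- The entries of the rows of length `1`. -/
noncomputable def singles (a : Fin l → ℕ) (P : Finset (Fin n) × Finset (Fin n)) :
    Finset (Fin n) :=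
  {v | ∃ i, a i = 1 ∧ Agree P.1 P.2 i v}

theorem mem_singles {P : Finset (Fin n) × Finset (Fin n)} {v : Fin n} :
    v ∈ singles a P ↔ ∃ i, a i = 1 ∧ Agree P.1 P.2 i v := by
  simp [singles]

/-- Both sets are replaced by their complements, and interchanged. -/
def swapCompl (P : Finset (Fin n) × Finset (Fin n)) : Finset (Fin n) × Finset (Fin n) :=
  (compl P.2, compl P.1)

theorem swapCompl_swapCompl (P : Finset (Fin n) × Finset (Fin n)) :
    swapCompl (swapCompl P) = P := by
  simp [swapCompl, compl_compl]

theorem IsPair.swapCompl {P : Finset (Fin n) × Finset (Fin n)} (h : IsPair a P) :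
    IsPair (fun i => a i.rev) (swapCompl P) :=
  ⟨by rw [QSchur.swapCompl, card_compl, h.card_snd],
    by rw [QSchur.swapCompl, card_compl, h.card_fst],
    h.dominated.compl (h.card_fst.trans h.card_snd.symm), fun i hi => by
      obtain ⟨v, hv⟩ := h.agree i.rev hi
      have := hv.compl h.card_fst h.card_snd
      rw [Fin.rev_rev] at this
      exact ⟨_, this⟩⟩

theorem IsPair.mem_singles_rev {P : Finset (Fin n) × Finset (Fin n)} (h : IsPair a P) {v : Fin n}
    (hv : v ∈ singles a P) : v.rev ∈ singles (fun i => a i.rev) (QSchur.swapCompl P) := by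
  obtain ⟨i, hi, hv⟩ := mem_singles.1 hv
  exact mem_singles.2 ⟨i.rev, by rwa [Fin.rev_rev], hv.compl h.card_fst h.card_snd⟩

theorem IsPair.singles_swapCompl {P : Finset (Fin n) × Finset (Fin n)} (h : IsPair a P) :
    singles (fun i => a i.rev) (QSchur.swapCompl P) = compl (singles a P) := by
  ext v
  rw [mem_compl]
  constructor
  · intro hv
    simpa only [Fin.rev_rev, swapCompl_swapCompl] using h.swapCompl.mem_singles_rev hv
  · intro hv
    simpa only [Fin.rev_rev] using h.mem_singles_rev hv

/-- The weight of a pair of column sets. -/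
noncomputable def pairWeight (a : Fin l → ℕ) (P : Finset (Fin n) × Finset (Fin n)) : Fin n →₀ ℕ :=
  ∑ v ∈ P.1, Finsupp.single v 1 + ∑ v ∈ P.2 \ singles a P, Finsupp.single v 1

/-- The entries of the short rows lie in both sets, so removing them from either gives the same
weight. This makes the weight compatible with the interchange in `swapCompl`. -/
theorem pairWeight_eq (a : Fin l → ℕ) (P : Finset (Fin n) × Finset (Fin n)) :
    pairWeight a P =
      ∑ v ∈ P.2, Finsupp.single v 1 + ∑ v ∈ P.1 \ singles a P, Finsupp.single v 1 := by
  have h1 : singles a P ⊆ P.1 := fun v hv => by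
    obtain ⟨i, -, hv⟩ := mem_singles.1 hv
    exact hv.1
  have h2 : singles a P ⊆ P.2 := fun v hv => by
    obtain ⟨i, -, hv⟩ := mem_singles.1 hv
    exact hv.2.1
  rw [pairWeight, ← Finset.sum_sdiff h1, ← Finset.sum_sdiff h2]
  abel

theorem compl_sdiff (C D : Finset (Fin n)) : compl (C \ D) = compl C \ compl D := by
  ext v
  simp [mem_compl]

theorem IsPair.pairWeight_swapCompl {P : Finset (Fin n) × Finset (Fin n)} (h : IsPair a P) :
    pairWeight (fun i => a i.rev) (QSchur.swapCompl P) =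
      Finsupp.mapDomain Fin.rev (pairWeight a P) := by
  rw [pairWeight_eq a, pairWeight, h.singles_swapCompl]
  simp only [QSchur.swapCompl]
  rw [← compl_sdiff, sum_single_compl, sum_single_compl, Finsupp.mapDomain_add]

theorem card_filter_lt_fin (i : Fin l) : #{j | j < i} = (i : ℕ) := by
  rw [Finset.filter_gt_eq_Iio, Fin.card_Iio]

theorem card_lt_of_strictMono {f : Fin l → Fin n} (hf : StrictMono f) (i : Fin l) :
    #{x ∈ univ.image f | x < f i} = i := by
  rw [card_filter_image hf.injective]
  simp only [hf.lt_iff_lt]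
  exact card_filter_lt_fin i

theorem Agree.eq_of_strictMono {f : Fin l → Fin n} (hf : StrictMono f) {D : Finset (Fin n)}
    {i : Fin l} {v : Fin n} (h : Agree (univ.image f) D i v) : v = f i := by
  obtain ⟨k, -, rfl⟩ := Finset.mem_image.1 h.1
  have := h.2.2.1
  rw [card_lt_of_strictMono hf] at this
  rw [Fin.ext this]

/-- The `i` rows below row `i` already have `g j < f i`. The rank of `f i` in the image of `g`
leaves room for no others, so row `i` is constant and `f i < g j` for every later row. -/
theorem Agree.of_step {f g : Fin l → Fin n} (hf : StrictMono f) (h : Step f g) {i : Fin l}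
    {v : Fin n} (hv : Agree (univ.image f) (univ.image g) i v) :
    g i = f i ∧ ∀ j, i < j → f i < g j := by
  obtain rfl := hv.eq_of_strictMono hf
  have h1 := hv.2.2.2
  rw [card_filter_image h.injective] at h1
  have hsub : ({j | j < i} : Finset (Fin l)) ⊆ ({j | g j < f i} : Finset (Fin l)) :=
    Finset.monotone_filter_right _ fun j _ hj => lt_of_le_of_lt (h.le j) (hf hj)
  have heq := Finset.eq_of_subset_of_card_le hsub (by
    rw [h1]
    exact le_of_eq (card_filter_lt_fin i).symm)
  have hiff : ∀ j, j < i ↔ g j < f i := fun j => by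
    have := Finset.ext_iff.1 heq j
    simpa using this
  have hi : g i = f i := le_antisymm (h.le i) (not_lt.1 fun hlt => lt_irrefl i ((hiff i).2 hlt))
  refine ⟨hi, fun j hij => lt_of_le_of_ne (not_lt.1 fun hlt => hij.not_gt ((hiff j).2 hlt)) ?_⟩
  rw [← hi]
  exact fun e => hij.ne (h.injective e)

/-- The first entries of the rows. -/
def firstEntry (ha : ∀ i, a i = 1 ∨ a i = 2) (T : Tab a n) (i : Fin l) : Fin n :=
  T i ⟨0, by rcases ha i with h | h <;> omega⟩

/-- The last entries of the rows. -/
def lastEntry (ha : ∀ i, a i = 1 ∨ a i = 2) (T : Tab a n) (i : Fin l) : Fin n :=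
  T i ⟨a i - 1, by rcases ha i with h | h <;> omega⟩

theorem lastEntry_of_one (ha : ∀ i, a i = 1 ∨ a i = 2) (T : Tab a n) {i : Fin l} (hi : a i = 1) :
    lastEntry ha T i = firstEntry ha T i :=
  congrArg (T i) (Fin.ext (by simp only; omega))

theorem lastEntry_of_two (ha : ∀ i, a i = 1 ∨ a i = 2) (T : Tab a n) {i : Fin l} (hi : a i = 2) :
    lastEntry ha T i = T i ⟨1, by omega⟩ :=
  congrArg (T i) (Fin.ext (by simp only; omega))

theorem entries_ext (ha : ∀ i, a i = 1 ∨ a i = 2) {T U : Tab a n}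
    (h1 : firstEntry ha T = firstEntry ha U) (h2 : lastEntry ha T = lastEntry ha U) : T = U := by
  funext i c
  by_cases hc : (c : ℕ) = 0
  · have : c = ⟨0, by rcases ha i with h | h <;> omega⟩ := Fin.ext hc
    rw [this]
    exact congrFun h1 i
  · have : c = ⟨a i - 1, by rcases ha i with h | h <;> omega⟩ :=
      Fin.ext (by rcases ha i with h | h <;> simp only <;> omega)
    rw [this]
    exact congrFun h2 i

theorem exists_entries (ha : ∀ i, a i = 1 ∨ a i = 2) (f g : Fin l → Fin n)
    (h : ∀ i, a i = 1 → g i = f i) :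
    ∃ T : Tab a n, firstEntry ha T = f ∧ lastEntry ha T = g := by
  refine ⟨fun i c => if (c : ℕ) = 0 then f i else g i, ?_, ?_⟩
  · funext i
    simp [firstEntry]
  · funext i
    rcases ha i with hi | hi
    · simp [lastEntry, hi, h i hi]
    · simp [lastEntry, hi]

/-- Since first entries increase, type B below a longer row `j` just says `f i < g j`, where `f` and
`g` are the first and last entries. Over all `j > i` this fixes the rank of `f i` among the last
entries, so the condition depends only on the two sets. -/
theorem isReverse_iff (ha : ∀ i, a i = 1 ∨ a i = 2) (T : Tab a n) :
    IsReverse T ↔ StrictMono (firstEntry ha T) ∧ Step (firstEntry ha T) (lastEntry ha T) ∧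
      ∀ i, a i = 1 → ∃ v, Agree (univ.image (firstEntry ha T)) (univ.image (lastEntry ha T)) i v := by
  constructor
  · intro h
    have hf : StrictMono (firstEntry ha T) := fun i j hij => h.col i j hij _ _
    have hle : ∀ i, lastEntry ha T i ≤ firstEntry ha T i := fun i => h.row i (by simp [Fin.le_def])
    have hone : ∀ i j, i < j → a i = 1 → firstEntry ha T i < lastEntry ha T j := by
      intro i j hij hi
      rcases ha j with hj | hj
      · rw [lastEntry_of_one ha T hj]
        exact hf hij
      · rw [lastEntry_of_two ha T hj]
        exact not_le.1 (h.typeB i j hij (by omega) 0 (by omega) (by omega) (hf hij).le)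
    have hs : Step (firstEntry ha T) (lastEntry ha T) := by
      refine ⟨hle, fun i j hij h1 h2 => ?_⟩
      rcases ha i with hi | hi
      · exact absurd h1 (not_le.2 (hone i j hij hi))
      · rcases ha j with hj | hj
        · rw [lastEntry_of_one ha T hj] at h1
          exact absurd h1 (not_le.2 (hf hij))
        · rw [lastEntry_of_two ha T hj] at h1 h2
          rw [lastEntry_of_two ha T hi] at h2
          exact h.typeA i j hij (by omega) 0 (by omega) (by omega) h1 h2
    refine ⟨hf, hs, fun i hi => ⟨firstEntry ha T i, Finset.mem_image_of_mem _ (Finset.mem_univ i),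
      ?_, card_lt_of_strictMono hf i, ?_⟩⟩
    · rw [← lastEntry_of_one ha T hi]
      exact Finset.mem_image_of_mem _ (Finset.mem_univ i)
    · rw [card_filter_image hs.injective]
      have : ∀ j, lastEntry ha T j < firstEntry ha T i ↔ j < i := by
        intro j
        rcases lt_trichotomy j i with hj | rfl | hj
        · exact iff_of_true (lt_of_le_of_lt (hle j) (hf hj)) hj
        · rw [lastEntry_of_one ha T hi]; simp
        · exact iff_of_false (hone i j hj hi).not_gt hj.not_gt
      simp only [this]
      exact card_filter_lt_fin i
  · rintro ⟨hf, hs, hagree⟩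
    refine ⟨?_, ?_, ?_, ?_⟩
    · intro i c d hcd
      rw [Fin.le_def] at hcd
      have hd := d.2
      rcases hcd.eq_or_lt with e | hlt
      · rw [Fin.ext e]
      · have h2 : a i = 2 := by rcases ha i with h | h <;> omega
        have hc0 : c = ⟨0, by omega⟩ := Fin.ext (by simp only; omega)
        have hd1 : d = ⟨1, by omega⟩ := Fin.ext (by simp only; omega)
        have := hs.le i
        rw [lastEntry_of_two ha T h2] at this
        rw [hc0, hd1]
        exact this
    · exact fun i j hij _ _ => hf hij
    · intro i j hij _ c hi hj h1 h2
      have hi2 : a i = 2 := by rcases ha i with h | h <;> omega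
      have hj2 : a j = 2 := by rcases ha j with h | h <;> omega
      obtain rfl : c = 0 := by omega
      refine hs.inversion i j hij ?_ ?_
      · rw [lastEntry_of_two ha T hj2]; exact h1
      · rw [lastEntry_of_two ha T hj2, lastEntry_of_two ha T hi2]; exact h2
    · intro i j hij hlt c hj hi h1 h2
      have hj2 : a j = 2 := by rcases ha j with h | h <;> omega
      have hi1 : a i = 1 := by rcases ha i with h | h <;> omega
      obtain rfl : c = 0 := by omega
      obtain ⟨v, hv⟩ := hagree i hi1
      have := (hv.of_step hf hs).2 j hij
      rw [lastEntry_of_two ha T hj2] at this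
      exact absurd h2 (not_le.2 this)

/-- The sets of first and of last entries of the rows. -/
def pair (ha : ∀ i, a i = 1 ∨ a i = 2) (T : Tab a n) : Finset (Fin n) × Finset (Fin n) :=
  (univ.image (firstEntry ha T), univ.image (lastEntry ha T))

theorem IsReverse.isPair {T : Tab a n} (ha : ∀ i, a i = 1 ∨ a i = 2) (h : IsReverse T) :
    IsPair a (pair ha T) := by
  obtain ⟨hf, hs, hagree⟩ := (isReverse_iff ha T).1 h
  exact ⟨card_univ_image hf.injective, card_univ_image hs.injective, hs.dominated hf.injective,
    hagree⟩

theorem IsReverse.eq_of_pair_eq {T U : Tab a n} (ha : ∀ i, a i = 1 ∨ a i = 2) (hT : IsReverse T)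
    (hU : IsReverse U) (h : pair ha T = pair ha U) : T = U := by
  obtain ⟨hf, hs, -⟩ := (isReverse_iff ha T).1 hT
  obtain ⟨hf', hs', -⟩ := (isReverse_iff ha U).1 hU
  obtain ⟨h1, h2⟩ := Prod.ext_iff.1 h
  have hfirst := strictMono_unique hf hf' h1
  refine entries_ext ha hfirst ?_
  rw [hfirst] at hs
  exact hs.unique hs' h2

theorem IsPair.exists_isReverse (ha : ∀ i, a i = 1 ∨ a i = 2)
    {P : Finset (Fin n) × Finset (Fin n)} (h : IsPair a P) :
    ∃ T : Tab a n, IsReverse T ∧ pair ha T = P := by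
  obtain ⟨C, D⟩ := P
  obtain ⟨f, hf, rfl⟩ := exists_strictMono h.card_fst
  obtain ⟨g, hg, rfl⟩ := exists_step_of_dominated hf.injective h.card_snd h.dominated
  obtain ⟨T, rfl, rfl⟩ := exists_entries ha f g fun i hi => by
    obtain ⟨v, hv⟩ := h.agree i hi
    exact (hv.of_step hf hg).1
  exact ⟨T, (isReverse_iff ha T).2 ⟨hf, hg, h.agree⟩, rfl⟩

theorem wt_eq_sum_entries (ha : ∀ i, a i = 1 ∨ a i = 2) (T : Tab a n) :
    wt T = ∑ i, Finsupp.single (firstEntry ha T i) 1 +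
      ∑ i with a i = 2, Finsupp.single (lastEntry ha T i) 1 := by
  rw [wt, Finset.sum_filter, ← Finset.sum_add_distrib]
  refine Finset.sum_congr rfl fun i _ => ?_
  rcases ha i with hi | hi
  · rw [if_neg (by omega), add_zero]
    refine Finset.sum_eq_single (⟨0, by omega⟩ : Fin (a i)) (fun c _ hc => ?_) (by simp)
    exact absurd (Fin.ext (by simp only; omega)) hc
  · rw [if_pos hi, lastEntry_of_two ha T hi]
    have : (univ : Finset (Fin (a i))) = {⟨0, by omega⟩, ⟨1, by omega⟩} := by
      ext c
      simp only [Finset.mem_univ, Finset.mem_insert, Finset.mem_singleton, true_iff, Fin.ext_iff]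
      omega
    rw [this, Finset.sum_pair (by simp)]
    rfl

theorem IsReverse.image_lastEntry {T : Tab a n} (ha : ∀ i, a i = 1 ∨ a i = 2) (h : IsReverse T) :
    ({i | a i = 2} : Finset (Fin l)).image (lastEntry ha T) =
      univ.image (lastEntry ha T) \ singles a (pair ha T) := by
  obtain ⟨hf, hs, hagree⟩ := (isReverse_iff ha T).1 h
  ext v
  simp only [Finset.mem_image, Finset.mem_sdiff, Finset.mem_filter, Finset.mem_univ, true_and,
    mem_singles, pair, not_exists, not_and]
  constructor
  · rintro ⟨k, hk, rfl⟩
    refine ⟨⟨k, rfl⟩, fun i hi hv => ?_⟩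
    have h1 := hv.eq_of_strictMono hf
    rw [← (hv.of_step hf hs).1] at h1
    rw [hs.injective h1] at hk
    omega
  · rintro ⟨⟨k, rfl⟩, hk⟩
    refine ⟨k, ?_, rfl⟩
    rcases ha k with h1 | h2
    · obtain ⟨v, hv⟩ := hagree k h1
      have := hv.eq_of_strictMono hf
      rw [← lastEntry_of_one ha T h1] at this
      exact absurd (this ▸ hv) (hk k h1)
    · exact h2

theorem IsReverse.wt_eq_pairWeight {T : Tab a n} (ha : ∀ i, a i = 1 ∨ a i = 2)
    (h : IsReverse T) : wt T = pairWeight a (pair ha T) := by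
  obtain ⟨hf, hs, -⟩ := (isReverse_iff ha T).1 h
  rw [pairWeight, wt_eq_sum_entries ha]
  change _ = ∑ v ∈ univ.image (firstEntry ha T), Finsupp.single v 1 +
    ∑ v ∈ univ.image (lastEntry ha T) \ singles a (pair ha T), Finsupp.single v 1
  rw [← h.image_lastEntry ha, Finset.sum_image fun i _ j _ e => hs.injective e,
    Finset.sum_image fun i _ j _ e => hf.injective e]

open Classical in
theorem revPoly_two (ha : ∀ i, a i = 1 ∨ a i = 2) (n : ℕ) : revPoly a n =
    ∑ P : Finset (Fin n) × Finset (Fin n) with IsPair a P,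
      MvPolynomial.monomial (pairWeight a P) 1 := by
  unfold revPoly
  refine Finset.sum_bij (fun T _ => pair ha T) ?_ ?_ ?_ ?_
  · intro T hT
    simpa using IsReverse.isPair ha (by simpa using hT)
  · intro T hT U hU e
    exact IsReverse.eq_of_pair_eq ha (by simpa using hT) (by simpa using hU) e
  · intro P hP
    obtain ⟨T, hT, e⟩ := IsPair.exists_isReverse (a := a) ha (by simpa using hP)
    exact ⟨T, by simpa using hT, e⟩
  · intro T hT
    rw [IsReverse.wt_eq_pairWeight ha (by simpa using hT)]

theorem rename_rev_revPoly_two (ha : ∀ i, a i = 1 ∨ a i = 2) (n : ℕ) :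
    MvPolynomial.rename Fin.rev (revPoly a n) = revPoly (fun i => a i.rev) n := by
  classical
  rw [revPoly_two ha, revPoly_two fun i => ha _, map_sum]
  refine Finset.sum_bij (fun P _ => swapCompl P) ?_ ?_ ?_ ?_
  · intro P hP
    simpa using IsPair.swapCompl (a := a) (by simpa using hP)
  · intro P _ Q _ e
    rw [← swapCompl_swapCompl P, e, swapCompl_swapCompl]
  · intro P hP
    have h := IsPair.swapCompl (a := fun i => a i.rev) (by simpa using hP)
    simp only [Fin.rev_rev] at h
    exact ⟨swapCompl P, by simpa using h, swapCompl_swapCompl P⟩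
  · intro P hP
    rw [MvPolynomial.rename_monomial, IsPair.pairWeight_swapCompl (by simpa using hP)]

theorem youngPoly_two (ha : ∀ i, a i = 1 ∨ a i = 2) (n : ℕ) : youngPoly a n = revPoly a n := by
  refine MvPolynomial.rename_injective _ Fin.rev_injective ?_
  rw [rename_rev_youngPoly, rename_rev_revPoly_two ha]

end TwoColumns

/-! ### Assembly of the equivalence -/

theorem youngPoly_eq_revPoly_of_const {l : ℕ} {a : Fin l → ℕ} (h : ∀ i j, a i = a j) (n : ℕ) :
    youngPoly a n = revPoly a n := by
  obtain ⟨p, rfl⟩ : ∃ p, a = fun _ => p := by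
    rcases isEmpty_or_nonempty (Fin l) with hl | ⟨⟨i⟩⟩
    · exact ⟨0, funext fun i => hl.elim i⟩
    · exact ⟨a i, funext fun j => h j i⟩
  exact youngPoly_rectangle l p n

theorem youngPoly_eq_revPoly_iff {l n : ℕ} {a : Fin l → ℕ} (ha : ∀ i, 0 < a i) (hl : l ≤ n) :
    youngPoly a n = revPoly a n ↔ (∀ i j, a i = a j) ∨ (∀ i, a i = 1 ∨ a i = 2) ∨
      (n = l ∧ ∀ i j : Fin l, (i : ℕ) + 1 = j → |(a i : ℤ) - a j| ≤ 1) := by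
  refine ⟨fun h => (sameWeights_of_poly_eq h).conditions ha hl, ?_⟩
  rintro (h | h | ⟨rfl, h⟩)
  · exact youngPoly_eq_revPoly_of_const h n
  · exact youngPoly_two h n
  · exact youngPoly_eq_revPoly_of_full ha h

/-- Lists allow the shapes to be compared before their lengths are known to agree. -/
theorem ofFn_eq_of_poly_eq {l l' n : ℕ} {a : Fin l → ℕ} {b : Fin l' → ℕ} (ha : ∀ i, 0 < a i)
    (hb : ∀ i, 0 < b i) (hl : l ≤ n) (hl' : l' ≤ n) (h : youngPoly a n = revPoly b n) :
    List.ofFn a = List.ofFn b := by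
  obtain rfl := length_eq_of_poly_eq ha hb hl hl' h
  rw [shape_eq_of_poly_eq hb hl h]

end QSchur

theorem mainTheorem8 {k m : ℕ} (α : Composition k) (β : Composition m) (n : ℕ)
    (hα : α.length ≤ n) (hβ : β.length ≤ n) :
    QSchur.yqs α n = QSchur.qs β n ↔
      α.blocks = β.blocks ∧
        ((∀ i j : Fin α.length, α.blocksFun i = α.blocksFun j) ∨
          (∀ i : Fin α.length, α.blocksFun i = 1 ∨ α.blocksFun i = 2) ∨
          (n = α.length ∧ ∀ i j : Fin α.length, (i : ℕ) + 1 = (j : ℕ) →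
            |(α.blocksFun i : ℤ) - (α.blocksFun j : ℤ)| ≤ 1)) := by
  have hblocks : QSchur.yqs α n = QSchur.qs β n → α.blocks = β.blocks := by
    rw [QSchur.yqs_eq, QSchur.qs_eq]
    intro h
    rw [← α.ofFn_blocksFun, ← β.ofFn_blocksFun]
    exact QSchur.ofFn_eq_of_poly_eq α.one_le_blocksFun β.one_le_blocksFun hα hβ h
  by_cases hab : α.blocks = β.blocks
  · obtain rfl : k = m := by rw [← α.blocks_sum, hab, β.blocks_sum]
    obtain rfl : α = β := Composition.ext hab
    rw [QSchur.yqs_eq, QSchur.qs_eq, QSchur.youngPoly_eq_revPoly_iff α.one_le_blocksFun hα]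
    simp
  · exact iff_of_false (fun h => hab (hblocks h)) fun h => hab h.1
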